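/- **Setting.** Let $p,L,r\in\mathbb N$ ($p,L,r\ge1$), $P=(p+1)r+(L-1)(r+1)r+r+1$. For $\theta\in\mathbb R^P$ let $g_\theta:\mathbb R^p\to\mathbb R$ be the fully connected ReLU network with $L$ hidden layers of width $r$ whose weights and shifts are the entries of $\theta$, and for $C\ge1$ let $f_\theta=(-C)\vee(g_\theta\wedge C)$. Let $(\mathbf X,Y)$ be random variables with values in $\mathbb R^p\times\mathbb R$, $Y=f(\mathbf X)+\varepsilon$, $\mathbb E[\varepsilon\mid\mathbf X]=0$ a.s., where, for constants $K\ge 1$ and $\sigma,\Gamma>0$: $|f|\le C$ holds $\mathbb P^{\mathbf X}$-a.e.; $\mathbb E[|\mathbf X|^2]\le K$; $\mathbb E[|\varepsilon|^k\mid\mathbf X]\le\frac{k!}{2}\sigma^2\Gamma^{k-2}$ a.s. for all integers $k\ge2$; and $\varepsilon$ is symmetric conditionally on $\mathbf X$. Let $\mathcal D_n=(\mathbf X_i,Y_i)_{i\le n}$ be i.i.d. copies of $(\mathbf X,Y)$. Put $R(h)=\mathbb E[(Y-h(\mathbf X))^2]$, $\mathcal E(h)=R(h)-R(f)$, and let $\theta^*$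 minimize $\theta\mapsto R(f_\theta)$ over $[-B,B]^P$, where $B\ge1$. For $\rho\in(0,1]$, $\lambda>0$ and $\ell_i(\theta)=(Y_i-f_\theta(\mathbf X_i))^2$ let $$\tilde R_{n,\rho}(\theta)=-\frac1\lambda\sum_{i=1}^n\log\big(e^{-\frac\lambda n\ell_i(\theta)}+1-\rho\big),$$ let $\tilde\Pi_{\lambda,\rho}(\cdot\mid\mathcal D_n)$ be the probability measure with density proportional to $e^{-\lambda\tilde R_{n,\rho}}$ with respect to the uniform distribution on $[-B,B]^P$, and let $\bar f_{\lambda,\rho}=\int f_\theta\,\tilde\Pi_{\lambda,\rho}(d\theta\mid\mathcal D_n)$. Write $\|\cdot\|$ for the norm of $L^2=L^2(\mathbb P^{\mathbf X})$ and, for $\alpha\in(0,1)$, $$\widehat C(\tau)=\{h\in L^2:\|h-\bar f_{\lambda,\rho}\|\le\tau\},\qquad \tau_\alpha=\inf\{\tau>0:\tilde\Pi_{\lambda,\rho}(\theta:\|f_\theta-\bar f_{\lambda,\rho}\|\le\tau\mid\mathcal D_n)>1-\alpha\},$$ $$\tau^\theta_\alpha=\inf\{\tau>0:\tilde\Pi_{\lambda,\rho}(\theta:|\theta|_\infty\le(2rB)^{-L}\tau\mid\mathcal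 D_n)>1-\alpha\}.$$ **Theorem (Credible balls).** For all $C\ge1$, $\sigma,\Gamma>0$ there are constants $\Xi_0,\Xi_1,\Xi_2>0$ depending only on $C,\sigma,\Gamma$ such that the following holds in the above setting for all $n\ge\max\{2,B,K,L,r,p\}$. 0. (Meaning of the constants.) For $\lambda=n/\Xi_0$ and all $\delta\in(0,1)$: if, given $\mathcal D_n$, $\tilde\theta$ is drawn from $\tilde\Pi_{\lambda,\rho}(\cdot\mid\mathcal D_n)$, then with probability at least $1-\delta$ (with respect to the data and the draw) $$\mathcal E(f_{\tilde\theta})\le12\,\mathcal E(f_{\theta^*})+\frac{\Xi_1}{n}\big(PL\log n+\log(2/\delta)\big),$$ and with probability at least $1-\delta$ $$\mathcal E(\bar f_{\lambda,\rho})\le12\,\mathcal E(f_{\theta^*})+\frac{\Xi_2}{n}\big(PL\log n+\log(2/\delta)\big).$$ 1. (Diameter.) For $\lambda=n/(2\Xi_0)$, $r_n^2=12\|f_{\theta^*}-f\|^2+\frac{\Xi_1}{n}PL\log n$ and every $\alpha\in(0,1)$, $$\mathbb P\Big(\operatorname{diam}\widehat C(\tau_\alpha)\le4\sqrt{2r_n^2+\tfrac{4(\Xi_1\vee\Xi_2)}{n}\log\tfrac2\alpha}\Big)\ge1-\alpha.$$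 2. (Coverage.) Let $\lambda=n/(2\Xi_0)$. For all $K\ge1$, $p\ge1$, $\alpha\in(0,1)$ and $A>0$ there is a constant $\kappa>1$, depending only on $K,p,\alpha,A$ and on $C,\sigma,\Gamma$, such that whenever $L\log(n)\,\mathcal E(f_{\theta^*})\le A\,PL\log(n)/\lambda$, one has, with $\xi=\kappa\sqrt{L\log n}>\sqrt{L\log n}$, $$\mathbb P\big(f\in\widehat C(\xi\,\tau^\theta_\alpha)\big)\ge1-\alpha.$$ -/

import Mathlib

open MeasureTheory ProbabilityTheory
open scoped ENNReal

namespace CredibleBalls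

/-! ### Fully connected ReLU networks -/

/-- Positions of the network parameters for input dimension `p`, `L` hidden layers and width `r`:
the first hidden layer, the hidden layers `2, …, L`, and the scalar output layer.
The last index is `some j` for the entry in column `j` of the weight matrix and `none` for the
entry of the shift vector. -/
abbrev ParamIndex (p L r : ℕ) : Type :=
  (Fin r × Option (Fin p)) ⊕ ((Fin (L - 1) × Fin r × Option (Fin r)) ⊕ Option (Fin r))

/-- The parameter space `ℝ^P`; its norm is the maximum norm. -/
abbrev Param (p L r : ℕ) : Type := ParamIndex p L r → ℝ

/-- The total number of network parameters. -/
def numParams (p L r : ℕ) : ℕ := (p + 1) * r + (L - 1) * (r + 1) * r + r + 1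

theorem card_paramIndex (p L r : ℕ) : Fintype.card (ParamIndex p L r) = numParams p L r := by
  simp [ParamIndex, numParams]
  ring

variable {p L r : ℕ}

/-- `hidden θ x k` is the output of the `(k + 1)`-st hidden layer, for `k < L`. -/
noncomputable def hidden (θ : Param p L r) (x : EuclideanSpace ℝ (Fin p)) : ℕ → Fin r → ℝ
  | 0 => fun i => max ((∑ j, θ (.inl (i, some j)) * x j) + θ (.inl (i, none))) 0
  | k + 1 => fun i =>
      if h : k < L - 1 then
        max ((∑ j, θ (.inr (.inl (⟨k, h⟩, i, some j))) * hidden θ x k j)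
          + θ (.inr (.inl (⟨k, h⟩, i, none)))) 0
      else 0

/-- The network `g_θ` (with `1 ≤ L` hidden layers). -/
noncomputable def network (θ : Param p L r) (x : EuclideanSpace ℝ (Fin p)) : ℝ :=
  (∑ j, θ (.inr (.inr (some j))) * hidden θ x (L - 1) j) + θ (.inr (.inr none))

/-- The clipped network `f_θ = (-C) ∨ (g_θ ∧ C)`. -/
noncomputable def clipped (C : ℝ) (θ : Param p L r) (x : EuclideanSpace ℝ (Fin p)) : ℝ :=
  max (-C) (min (network θ x) C)

/-- The cube `[-B, B]^P`. -/
def cube (p L r : ℕ) (B : ℝ) : Set (Param p L r) := Set.Icc (fun _ => -B) (fun _ => B)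

/-- The prior: the uniform distribution on the cube. -/
noncomputable def prior (p L r : ℕ) (B : ℝ) : Measure (Param p L r) :=
  ProbabilityTheory.cond volume (cube p L r B)

/-! ### The regression model -/

section Model

variable {Ω : Type*} [MeasurableSpace Ω]

/-- The regression model `Y = f(X) + ε` with `E[ε | X] = 0`, a regression function bounded by `C`,
second moment of the input at most `K`, and conditionally sub-Gaussian (with constants `σ, Γ`)
and conditionally symmetric noise `ε`. -/
structure IsBoundedRegression (P : Measure Ω) [IsProbabilityMeasure P]
    (X : Ω → EuclideanSpace ℝ (Fin p)) (Y : Ω → ℝ) (f : EuclideanSpace ℝ (Fin p) → ℝ)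
    (C K σ Γ : ℝ) : Prop where
  measurable_X : Measurable X
  measurable_Y : Measurable Y
  measurable_f : Measurable f
  integrable_noise : Integrable (fun ω => Y ω - f (X ω)) P
  condExp_noise :
    P[(fun ω => Y ω - f (X ω)) | MeasurableSpace.comap X inferInstance] =ᵐ[P] 0
  bounded : ∀ᵐ x ∂(P.map X), |f x| ≤ C
  integrable_input : Integrable (fun ω => ‖X ω‖ ^ 2) P
  second_moment : ∫ ω, ‖X ω‖ ^ 2 ∂P ≤ K
  integrable_moments : ∀ k : ℕ, 2 ≤ k → Integrable (fun ω => |Y ω - f (X ω)| ^ k) P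
  conditional_moments : ∀ k : ℕ, 2 ≤ k →
    ∀ᵐ ω ∂P, (P[(fun ω => |Y ω - f (X ω)| ^ k) | MeasurableSpace.comap X inferInstance]) ω
      ≤ (k.factorial : ℝ) / 2 * σ ^ 2 * Γ ^ (k - 2)
  conditional_symmetry : ∀ᵐ x ∂(P.map X),
    (condDistrib (fun ω => Y ω - f (X ω)) X P x).map (fun e => -e)
      = condDistrib (fun ω => Y ω - f (X ω)) X P x

/-- `D` consists of `n` i.i.d. copies of `(X, Y)`. -/
structure IsSample (P : Measure Ω) (X : Ω → EuclideanSpace ℝ (Fin p)) (Y : Ω → ℝ) {n : ℕ}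
    (D : Fin n → Ω → EuclideanSpace ℝ (Fin p) × ℝ) : Prop where
  identDistrib : ∀ i, IdentDistrib (D i) (fun ω => (X ω, Y ω)) P P
  indep : iIndepFun D P

/-- The prediction risk `R(h) = E[(Y - h(X))²]`. -/
noncomputable def risk (P : Measure Ω) (X : Ω → EuclideanSpace ℝ (Fin p)) (Y : Ω → ℝ)
    (h : EuclideanSpace ℝ (Fin p) → ℝ) : ℝ :=
  ∫ ω, (Y ω - h (X ω)) ^ 2 ∂P

/-- The excess risk `ℰ(h) = R(h) - R(f)`. -/
noncomputable def excessRisk (P : Measure Ω) (X : Ω → EuclideanSpace ℝ (Fin p)) (Y : Ω → ℝ)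
    (f h : EuclideanSpace ℝ (Fin p) → ℝ) : ℝ :=
  risk P X Y h - risk P X Y f

/-- `θs` is an oracle: it minimizes the prediction risk over the cube. -/
def IsOracle (P : Measure Ω) (X : Ω → EuclideanSpace ℝ (Fin p)) (Y : Ω → ℝ) (C B : ℝ)
    (θs : Param p L r) : Prop :=
  θs ∈ cube p L r B ∧ IsMinOn (fun θ => risk P X Y (clipped C θ)) (cube p L r B) θs

end Model

/-! ### The surrogate posterior and its mean -/

/-- The loss `ℓ(θ) = (y - f_θ(x))²` at the data point `z = (x, y)`. -/
noncomputable def loss (C : ℝ) (z : EuclideanSpace ℝ (Fin p) × ℝ) (θ : Param p L r) : ℝ :=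
  (z.2 - clipped C θ z.1) ^ 2

/-- The corrected stochastic empirical risk
`-(1/lam) ∑ i, log (exp (-(lam/n) ℓ_i(θ)) + 1 - ρ)` for given data `d`. -/
noncomputable def surrogateRisk {n : ℕ} (C lam ρ : ℝ) (d : Fin n → EuclideanSpace ℝ (Fin p) × ℝ)
    (θ : Param p L r) : ℝ :=
  -(1 / lam) * ∑ i, Real.log (Real.exp (-(lam / n) * loss C (d i) θ) + 1 - ρ)

/-- The surrogate posterior: the probability measure with density proportional to
`exp (-lam * surrogateRisk)` with respect to the prior. -/
noncomputable def surrogatePosterior (L r : ℕ) {n : ℕ} (C B lam ρ : ℝ)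
    (d : Fin n → EuclideanSpace ℝ (Fin p) × ℝ) : Measure (Param p L r) :=
  (prior p L r B).tilted (fun θ => -lam * surrogateRisk C lam ρ d θ)

/-- The posterior mean `x ↦ ∫ f_θ(x) dΠ(θ)`. -/
noncomputable def posteriorMean (L r : ℕ) {n : ℕ} (C B lam ρ : ℝ)
    (d : Fin n → EuclideanSpace ℝ (Fin p) × ℝ) (x : EuclideanSpace ℝ (Fin p)) : ℝ :=
  ∫ θ, clipped C θ x ∂(surrogatePosterior L r C B lam ρ d)

/-! ### Credible balls -/

/-- The norm of `L²(μ)`. -/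
noncomputable def l2Norm (μ : Measure (EuclideanSpace ℝ (Fin p)))
    (h : EuclideanSpace ℝ (Fin p) → ℝ) : ℝ :=
  (eLpNorm h 2 μ).toReal

/-- The `L²(μ)`-diameter of a set of functions. -/
noncomputable def l2Diam (μ : Measure (EuclideanSpace ℝ (Fin p)))
    (S : Set (EuclideanSpace ℝ (Fin p) → ℝ)) : ℝ≥0∞ :=
  ⨆ g ∈ S, ⨆ h ∈ S, eLpNorm (fun x => g x - h x) 2 μ

/-- The ball `{h ∈ L²(μ) : ‖h - c‖ ≤ τ}`. -/
def l2Ball (μ : Measure (EuclideanSpace ℝ (Fin p))) (c : EuclideanSpace ℝ (Fin p) → ℝ) (τ : ℝ) :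
    Set (EuclideanSpace ℝ (Fin p) → ℝ) :=
  {h | MemLp h 2 μ ∧ l2Norm μ (fun x => h x - c x) ≤ τ}

/-- The critical value `τ_α`, where `μ` is the distribution of the input. -/
noncomputable def criticalValue (L r : ℕ) {n : ℕ} (C B lam ρ : ℝ)
    (μ : Measure (EuclideanSpace ℝ (Fin p))) (d : Fin n → EuclideanSpace ℝ (Fin p) × ℝ)
    (α : ℝ) : ℝ :=
  sInf {τ : ℝ | 0 < τ ∧ 1 - α < (surrogatePosterior L r C B lam ρ d).real
    {θ | l2Norm μ (fun x => clipped C θ x - posteriorMean L r C B lam ρ d x) ≤ τ}}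

/-- The critical value `τ_α^θ` on the level of the parameters, with `Δ(L, r) = (2rB)^L`. -/
noncomputable def paramCriticalValue (L r : ℕ) {n : ℕ} (C B lam ρ : ℝ)
    (d : Fin n → EuclideanSpace ℝ (Fin p) × ℝ) (α : ℝ) : ℝ :=
  sInf {τ : ℝ | 0 < τ ∧ 1 - α < (surrogatePosterior L r C B lam ρ d).real
    {θ | ‖θ‖ ≤ ((2 * (r : ℝ) * B) ^ L)⁻¹ * τ}}

/-- The credible ball of radius `τ` around the posterior mean. -/
def credibleBall (L r : ℕ) {n : ℕ} (C B lam ρ : ℝ)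
    (μ : Measure (EuclideanSpace ℝ (Fin p))) (d : Fin n → EuclideanSpace ℝ (Fin p) × ℝ) (τ : ℝ) :
    Set (EuclideanSpace ℝ (Fin p) → ℝ) :=
  l2Ball μ (posteriorMean L r C B lam ρ d) τ

/-- The squared rate `r_n² = 12 ‖f_{θ*} - f‖² + (Ξ₁ / n) P L log n`. -/
noncomputable def rateSq (C Ξ₁ : ℝ) (n : ℕ) (μ : Measure (EuclideanSpace ℝ (Fin p)))
    (f : EuclideanSpace ℝ (Fin p) → ℝ) (θs : Param p L r) : ℝ :=
  12 * l2Norm μ (fun x => clipped C θs x - f x) ^ 2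
    + Ξ₁ / n * (numParams p L r * L * Real.log n)

/-- The sample size dominates `2`, `B`, `K`, `L`, `r` and `p`. -/
def IsLargeSample (n p L r : ℕ) (B K : ℝ) : Prop :=
  2 ≤ n ∧ B ≤ n ∧ K ≤ n ∧ L ≤ n ∧ r ≤ n ∧ p ≤ n

end CredibleBalls

open CredibleBalls

/-!
For symmetric noise `ε` with Bernstein moments and a temperature `n / Ξ` with `Ξ` large, the
likelihood ratio of the surrogate loss at `θ` against the truth has an expectation at most
`exp (-c ‖f_θ - f‖²)`: averaging over `±ε` cancels the term linear in `ε`, and since `1 - ρ ≤ 1`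
the Gaussian term keeps about half of the weight. Integrated against the prior, the numerator of
the posterior is therefore small away from `f`. The normalizing constant is bounded below through
the reciprocal moments of the likelihood ratio on a small sup-norm ball around `θ*`, on which the
network is Lipschitz in its parameters; this ball has prior mass of order `exp (-c P L log n)`.
Together these bound a posterior exponential moment of `n ‖f_θ - f‖²` with high probability, from
which the oracle inequalities (by Markov and Jensen) and the diameter bound follow.

For the coverage, the same comparison of a numerator with the normalizing constant, now on the
scale `√(P / n)`, shows that the parameter ball of radius `(2rB)^{-L} ζ √(P / n)` has posterior
mass at most `1 - α` once `ζ` is small. Hence `τ_α^θ ≥ ζ √(P / n)`, which after inflation by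
`κ √(L log n)` exceeds the error of the posterior mean.
-/

namespace CredibleBalls

/-! ### Noise with Bernstein moments -/

/-- Bernstein's moment condition with variance proxy `σ ^ 2` and scale `Γ`. The moments are
Lebesgue integrals, so that the condition includes their finiteness. -/
def HasBernsteinMoments (ν : Measure ℝ) (σ Γ : ℝ) : Prop :=
  ∀ k : ℕ, 2 ≤ k →
    ∫⁻ e, ENNReal.ofReal (|e| ^ k) ∂ν ≤ ENNReal.ofReal (k.factorial / 2 * σ ^ 2 * Γ ^ (k - 2))

theorem ofReal_sq_mul_exp_eq_tsum {s : ℝ} (hs : 0 ≤ s) (e : ℝ) :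
    ENNReal.ofReal (e ^ 2 * Real.exp (s * |e|))
      = ∑' k : ℕ, ENNReal.ofReal (s ^ k / k.factorial) * ENNReal.ofReal (|e| ^ (k + 2)) := by
  have hsum : HasSum (fun k : ℕ => s ^ k / k.factorial * |e| ^ (k + 2))
      (e ^ 2 * Real.exp (s * |e|)) := by
    have hexp := (NormedSpace.expSeries_div_hasSum_exp (s * |e|)).mul_left (e ^ 2)
    rw [← Real.exp_eq_exp_ℝ] at hexp
    refine hexp.congr_fun fun k => ?_
    rw [← sq_abs e]
    ring
  rw [← hsum.tsum_eq, ENNReal.ofReal_tsum_of_nonneg (fun k => by positivity) hsum.summable]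
  exact tsum_congr fun k => ENNReal.ofReal_mul (by positivity)

theorem pow_div_factorial_mul_bernstein_eq (s σ Γ : ℝ) (k : ℕ) :
    s ^ k / k.factorial * ((k + 2).factorial / 2 * σ ^ 2 * Γ ^ k)
      = σ ^ 2 * (((k + 2).choose 2 : ℝ) * (s * Γ) ^ k) := by
  have hfact : ((k + 2).factorial : ℝ) = (k + 2).choose 2 * k.factorial * 2 := by
    exact_mod_cast (Nat.add_choose_mul_factorial_mul_factorial k 2).symm
  rw [hfact, mul_pow]
  field_simp

namespace HasBernsteinMoments

variable {ν : Measure ℝ} {σ Γ s : ℝ}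

theorem lintegral_sq_mul_exp_le (h : HasBernsteinMoments ν σ Γ) (hΓ : 0 ≤ Γ) (hs : 0 ≤ s)
    (hsΓ : s * Γ < 1) :
    ∫⁻ e, ENNReal.ofReal (e ^ 2 * Real.exp (s * |e|)) ∂ν
      ≤ ENNReal.ofReal (σ ^ 2 / (1 - s * Γ) ^ 3) := by
  have hseries : HasSum (fun k : ℕ => σ ^ 2 * (((k + 2).choose 2 : ℝ) * (s * Γ) ^ k))
      (σ ^ 2 / (1 - s * Γ) ^ 3) := by
    rw [← mul_one_div]
    refine HasSum.mul_left (σ ^ 2) (hasSum_choose_mul_geometric_of_norm_lt_one 2 ?_)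
    rwa [Real.norm_of_nonneg (by positivity)]
  simp_rw [ofReal_sq_mul_exp_eq_tsum hs]
  rw [lintegral_tsum fun k => by fun_prop, ← hseries.tsum_eq,
    ENNReal.ofReal_tsum_of_nonneg (fun k => by positivity) hseries.summable]
  refine ENNReal.tsum_le_tsum fun k => ?_
  rw [lintegral_const_mul _ (by fun_prop), ← pow_div_factorial_mul_bernstein_eq,
    ENNReal.ofReal_mul (by positivity)]
  gcongr
  exact h (k + 2) (by omega)

theorem integrable_sq_mul_exp (h : HasBernsteinMoments ν σ Γ) (hΓ : 0 ≤ Γ) (hs : 0 ≤ s)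
    (hsΓ : s * Γ < 1) : Integrable (fun e => e ^ 2 * Real.exp (s * |e|)) ν := by
  refine ⟨by fun_prop, ?_⟩
  rw [hasFiniteIntegral_iff_ofReal (ae_of_all _ fun e => by positivity)]
  exact (h.lintegral_sq_mul_exp_le hΓ hs hsΓ).trans_lt ENNReal.ofReal_lt_top

theorem integral_sq_mul_exp_le (h : HasBernsteinMoments ν σ Γ) (hΓ : 0 ≤ Γ) (hs : 0 ≤ s)
    (hsΓ : s * Γ < 1) :
    ∫ e, e ^ 2 * Real.exp (s * |e|) ∂ν ≤ σ ^ 2 / (1 - s * Γ) ^ 3 := by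
  rw [integral_eq_lintegral_of_nonneg_ae (ae_of_all _ fun e => by positivity) (by fun_prop)]
  exact ENNReal.toReal_le_of_le_ofReal (div_nonneg (sq_nonneg σ) (pow_nonneg (by linarith) 3))
    (h.lintegral_sq_mul_exp_le hΓ hs hsΓ)

theorem lintegral_sq_le (h : HasBernsteinMoments ν σ Γ) :
    ∫⁻ e, ENNReal.ofReal (e ^ 2) ∂ν ≤ ENNReal.ofReal (σ ^ 2) := by
  simpa [Nat.factorial] using h 2 le_rfl

theorem integrable_sq (h : HasBernsteinMoments ν σ Γ) : Integrable (fun e => e ^ 2) ν := by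
  refine ⟨by fun_prop, ?_⟩
  rw [hasFiniteIntegral_iff_ofReal (ae_of_all _ fun e => by positivity)]
  exact h.lintegral_sq_le.trans_lt ENNReal.ofReal_lt_top

theorem integral_sq_le (h : HasBernsteinMoments ν σ Γ) : ∫ e, e ^ 2 ∂ν ≤ σ ^ 2 := by
  rw [integral_eq_lintegral_of_nonneg_ae (ae_of_all _ fun e => by positivity) (by fun_prop)]
  exact ENNReal.toReal_le_of_le_ofReal (by positivity) h.lintegral_sq_le

end HasBernsteinMoments

theorem lintegral_le_of_add_neg_le {ν : Measure ℝ} [ν.IsNegInvariant] {F U : ℝ → ℝ}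
    (hF : Measurable F) (hF0 : ∀ e, 0 ≤ F e) (hU : Integrable U ν)
    (hFU : ∀ e, F e + F (-e) ≤ 2 * U e) :
    ∫⁻ e, ENNReal.ofReal (F e) ∂ν ≤ ENNReal.ofReal (∫ e, U e ∂ν) := by
  have hU0 : ∀ e, 0 ≤ U e := fun e => by linarith [hF0 e, hF0 (-e), hFU e]
  have hdouble : 2 * ∫⁻ e, ENNReal.ofReal (F e) ∂ν ≤ 2 * ENNReal.ofReal (∫ e, U e ∂ν) := by
    rw [ofReal_integral_eq_lintegral_ofReal hU (ae_of_all _ hU0), two_mul]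
    nth_rewrite 2 [← lintegral_neg_eq_self]
    rw [← lintegral_add_left (by fun_prop), ← lintegral_const_mul' _ _ (by simp)]
    refine lintegral_mono fun e => ?_
    rw [← ENNReal.ofReal_add (hF0 _) (hF0 _), ← ENNReal.ofReal_ofNat 2,
      ← ENNReal.ofReal_mul (by norm_num)]
    exact ENNReal.ofReal_le_ofReal (hFU e)
  exact (ENNReal.mul_le_mul_iff_right (by simp) (by simp)).1 hdouble

/-! ### Likelihood ratios of the surrogate loss -/

theorem cosh_sub_one_le (y : ℝ) : Real.cosh y - 1 ≤ y ^ 2 / 2 * Real.exp |y| := by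
  have hexp : Real.exp |y| - 1 ≤ |y| * Real.exp |y| := by
    have h := mul_le_mul_of_nonneg_right (Real.one_sub_le_exp_neg |y|) (Real.exp_pos |y|).le
    rw [← Real.exp_add, neg_add_cancel, Real.exp_zero] at h
    linarith
  calc Real.cosh y - 1 = (Real.exp |y| - 1) ^ 2 / (2 * Real.exp |y|) := by
        rw [← Real.cosh_abs, Real.cosh_eq, Real.exp_neg]
        field_simp
        ring
    _ ≤ (|y| * Real.exp |y|) ^ 2 / (2 * Real.exp |y|) := by
        gcongr
        exact sub_nonneg.2 (Real.one_le_exp (abs_nonneg y))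
    _ = y ^ 2 / 2 * Real.exp |y| := by
        rw [mul_pow, sq_abs]
        field_simp

theorem cosh_mul_sub_one_le (c e : ℝ) :
    Real.cosh (c * e) - 1 ≤ c ^ 2 / 2 * (e ^ 2 * Real.exp (|c| * |e|)) := by
  have h := cosh_sub_one_le (c * e)
  rw [abs_mul, mul_pow] at h
  linarith

/-- The factor `exp (-u ^ 2 / Ξ) + a` which an observation with residual `u` contributes to the
density of the surrogate posterior at inverse temperature `n / Ξ`; the surrogate risk has
`a = 1 - ρ`. -/
noncomputable def residualWeight (Ξ a u : ℝ) : ℝ := Real.exp (-(u ^ 2 / Ξ)) + a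

/-- The share of the Gaussian term in the residual weight. -/
noncomputable def gaussianShare (Ξ a u : ℝ) : ℝ :=
  Real.exp (-(u ^ 2 / Ξ)) / residualWeight Ξ a u

section ResidualWeight

variable {Ξ a : ℝ}

theorem residualWeight_pos (ha : 0 ≤ a) (u : ℝ) : 0 < residualWeight Ξ a u := by
  unfold residualWeight
  positivity

@[fun_prop]
theorem measurable_residualWeight (Ξ a : ℝ) : Measurable (residualWeight Ξ a) := by
  unfold residualWeight
  fun_prop

theorem residualWeight_neg (Ξ a u : ℝ) : residualWeight Ξ a (-u) = residualWeight Ξ a u := by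
  simp only [residualWeight, neg_sq]

theorem residualWeight_le (hΞ : 0 ≤ Ξ) (a u : ℝ) : residualWeight Ξ a u ≤ 1 + a := by
  unfold residualWeight
  gcongr
  exact Real.exp_le_one_iff.2 (neg_nonpos.2 (by positivity))

theorem gaussianShare_neg (Ξ a u : ℝ) : gaussianShare Ξ a (-u) = gaussianShare Ξ a u := by
  simp only [gaussianShare, residualWeight_neg, neg_sq]

theorem gaussianShare_nonneg (ha : 0 ≤ a) (u : ℝ) : 0 ≤ gaussianShare Ξ a u :=
  div_nonneg (Real.exp_pos _).le (residualWeight_pos ha u).le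

theorem gaussianShare_le_one (ha : 0 ≤ a) (u : ℝ) : gaussianShare Ξ a u ≤ 1 :=
  (div_le_one (residualWeight_pos ha u)).2 (le_add_of_nonneg_right ha)

theorem le_gaussianShare (hΞ : 0 ≤ Ξ) (ha : 0 ≤ a) (ha1 : a ≤ 1) (u : ℝ) :
    (1 - u ^ 2 / Ξ) / 2 ≤ gaussianShare Ξ a u := by
  have hexp := Real.one_sub_le_exp_neg (u ^ 2 / Ξ)
  have hweight : residualWeight Ξ a u ≤ 2 := (residualWeight_le hΞ a u).trans (by linarith)
  calc (1 - u ^ 2 / Ξ) / 2 ≤ Real.exp (-(u ^ 2 / Ξ)) / 2 := by gcongr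
    _ ≤ gaussianShare Ξ a u :=
        div_le_div_of_nonneg_left (Real.exp_pos _).le (residualWeight_pos ha u) hweight

theorem residualWeight_sub_div (ha : 0 ≤ a) (d e : ℝ) :
    residualWeight Ξ a (e - d) / residualWeight Ξ a e
      = 1 + gaussianShare Ξ a e * (Real.exp (2 * d / Ξ * e - d ^ 2 / Ξ) - 1) := by
  have hne := (residualWeight_pos (Ξ := Ξ) ha e).ne'
  have hshift : Real.exp (-((e - d) ^ 2 / Ξ))
      = Real.exp (-(e ^ 2 / Ξ)) * Real.exp (2 * d / Ξ * e - d ^ 2 / Ξ) := by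
    rw [← Real.exp_add]
    ring_nf
  rw [gaussianShare, div_eq_iff hne, add_mul, one_mul, div_mul_eq_mul_div, div_mul_cancel₀ _ hne]
  simp only [residualWeight, hshift]
  ring

theorem residualWeight_sub_div_add_neg (ha : 0 ≤ a) (d e : ℝ) :
    residualWeight Ξ a (e - d) / residualWeight Ξ a e
        + residualWeight Ξ a (-e - d) / residualWeight Ξ a (-e)
      = 2 * (1 + gaussianShare Ξ a e
          * (Real.exp (-(d ^ 2 / Ξ)) * Real.cosh (2 * d / Ξ * e) - 1)) := by
  rw [residualWeight_sub_div ha, residualWeight_sub_div ha, gaussianShare_neg, Real.cosh_eq,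
    sub_eq_add_neg (_ * e), sub_eq_add_neg (_ * -e), Real.exp_add, Real.exp_add, mul_neg]
  ring

theorem residualWeight_sub_div_add_neg_le (hΞ : 0 ≤ Ξ) (ha : 0 ≤ a) (ha1 : a ≤ 1) (d e : ℝ) :
    residualWeight Ξ a (e - d) / residualWeight Ξ a e
        + residualWeight Ξ a (-e - d) / residualWeight Ξ a (-e)
      ≤ 2 * (1 - (1 - Real.exp (-(d ^ 2 / Ξ))) / 2
          + (1 - Real.exp (-(d ^ 2 / Ξ))) / (2 * Ξ) * e ^ 2
          + (2 * d / Ξ) ^ 2 / 2 * (e ^ 2 * Real.exp (|2 * d / Ξ| * |e|))) := by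
  set w := gaussianShare Ξ a e
  set q := Real.exp (-(d ^ 2 / Ξ))
  set c := Real.cosh (2 * d / Ξ * e)
  have hq : q ≤ 1 := Real.exp_le_one_iff.2 (neg_nonpos.2 (by positivity))
  have hc : 1 ≤ c := Real.one_le_cosh _
  have hwc : w * (q * (c - 1)) ≤ c - 1 := by
    have hwq : w * q ≤ 1 :=
      mul_le_one₀ (gaussianShare_le_one ha e) (Real.exp_pos _).le hq
    nlinarith
  have hwq : (1 - e ^ 2 / Ξ) / 2 * (1 - q) ≤ w * (1 - q) := by
    gcongr
    exact le_gaussianShare hΞ ha ha1 e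
  have hcosh := cosh_mul_sub_one_le (2 * d / Ξ) e
  rw [residualWeight_sub_div_add_neg ha,
    show (1 - q) / (2 * Ξ) * e ^ 2 = e ^ 2 / Ξ * (1 - q) / 2 by ring]
  linarith

/-- Jensen's inequality for the two-point distribution with masses `gaussianShare` and
`1 - gaussianShare`. -/
theorem residualWeight_div_sub_le (ha : 0 ≤ a) (d e : ℝ) :
    residualWeight Ξ a e / residualWeight Ξ a (e - d)
      ≤ Real.exp (-(gaussianShare Ξ a e * (2 * d / Ξ * e - d ^ 2 / Ξ))) := by
  set w := gaussianShare Ξ a e with hw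
  set v := 2 * d / Ξ * e - d ^ 2 / Ξ with hv
  have hw0 : 0 ≤ w := gaussianShare_nonneg ha e
  have hw1 : w ≤ 1 := gaussianShare_le_one ha e
  have hjensen : Real.exp (w * v) ≤ 1 + w * (Real.exp v - 1) := by
    have h := convexOn_exp.2 (Set.mem_univ v) (Set.mem_univ 0) hw0 (sub_nonneg.2 hw1)
      (add_sub_cancel w 1)
    simp only [smul_eq_mul, mul_zero, add_zero, Real.exp_zero, mul_one] at h
    linarith
  rw [← inv_div, residualWeight_sub_div ha, ← hw, ← hv, Real.exp_neg]
  gcongr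

theorem residualWeight_div_sub_add_neg_le (hΞ : 0 ≤ Ξ) (ha : 0 ≤ a) (d e : ℝ) :
    residualWeight Ξ a e / residualWeight Ξ a (e - d)
        + residualWeight Ξ a (-e) / residualWeight Ξ a (-e - d)
      ≤ 2 * (Real.exp (d ^ 2 / Ξ)
          * (1 + (2 * d / Ξ) ^ 2 / 2 * (e ^ 2 * Real.exp (|2 * d / Ξ| * |e|)))) := by
  set w := gaussianShare Ξ a e
  set y := 2 * d / Ξ * e
  have hw0 : 0 ≤ w := gaussianShare_nonneg ha e
  have hw1 : w ≤ 1 := gaussianShare_le_one ha e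
  have hplus := residualWeight_div_sub_le (Ξ := Ξ) ha d e
  have hminus := residualWeight_div_sub_le (Ξ := Ξ) ha d (-e)
  rw [gaussianShare_neg, mul_neg] at hminus
  have hcosh : Real.cosh (w * y) ≤ Real.cosh y := by
    rw [Real.cosh_le_cosh, abs_mul, abs_of_nonneg hw0]
    exact mul_le_of_le_one_left (abs_nonneg _) hw1
  calc _ ≤ Real.exp (-(w * (y - d ^ 2 / Ξ))) + Real.exp (-(w * (-y - d ^ 2 / Ξ))) :=
        add_le_add hplus hminus
    _ = 2 * (Real.exp (w * (d ^ 2 / Ξ)) * Real.cosh (w * y)) := by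
        rw [show -(w * (y - d ^ 2 / Ξ)) = w * (d ^ 2 / Ξ) + -(w * y) by ring,
          show -(w * (-y - d ^ 2 / Ξ)) = w * (d ^ 2 / Ξ) + w * y by ring,
          Real.exp_add, Real.exp_add, Real.cosh_eq]
        ring
    _ ≤ 2 * (Real.exp (d ^ 2 / Ξ) * Real.cosh y) := by
        gcongr
        exact mul_le_of_le_one_left (by positivity) hw1
    _ ≤ _ := by
        gcongr
        linarith [cosh_mul_sub_one_le (2 * d / Ξ) e]

end ResidualWeight

/-- The temperature `Ξ` is large compared to the bound `C` on the regression functions and to the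
noise parameters `σ` and `Γ`; the numerical constants are what the two likelihood ratio bounds
below need. -/
structure IsTemperature (C σ Γ Ξ : ℝ) : Prop where
  le : 8 * C * Γ + 32 * C ^ 2 + 256 * σ ^ 2 ≤ Ξ
  C_pos : 0 < C
  Γ_pos : 0 < Γ

namespace IsTemperature

variable {C σ Γ Ξ d : ℝ}

theorem pos (h : IsTemperature C σ Γ Ξ) : 0 < Ξ := by
  have hC := h.C_pos
  have hΓ := h.Γ_pos
  exact lt_of_lt_of_le (by positivity) h.le

theorem abs_mul_scale_le (h : IsTemperature C σ Γ Ξ) (hd : |d| ≤ 2 * C) :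
    |2 * d / Ξ| * Γ ≤ 1 / 2 := by
  rw [abs_div, abs_mul, abs_of_pos h.pos, abs_two, div_mul_eq_mul_div, div_le_iff₀ h.pos]
  have hdΓ : |d| * Γ ≤ 2 * C * Γ := mul_le_mul_of_nonneg_right hd h.Γ_pos.le
  nlinarith [h.le, sq_nonneg C, sq_nonneg σ]

theorem sq_div_le (h : IsTemperature C σ Γ Ξ) (hd : |d| ≤ 2 * C) : d ^ 2 / Ξ ≤ 1 / 8 := by
  rw [div_le_iff₀ h.pos]
  have hsq : d ^ 2 ≤ (2 * C) ^ 2 := sq_le_sq' (abs_le.1 hd).1 (abs_le.1 hd).2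
  nlinarith [h.le, sq_nonneg σ, mul_pos h.C_pos h.Γ_pos]

theorem variance_div_le (h : IsTemperature C σ Γ Ξ) : σ ^ 2 / Ξ ≤ 1 / 256 := by
  rw [div_le_iff₀ h.pos]
  nlinarith [h.le, sq_nonneg C, mul_pos h.C_pos h.Γ_pos]

end IsTemperature

namespace HasBernsteinMoments

variable {ν : Measure ℝ} {C σ Γ Ξ a d : ℝ}

theorem integrable_sq_mul_exp_scale (h : HasBernsteinMoments ν σ Γ) (hΞ : IsTemperature C σ Γ Ξ)
    (hd : |d| ≤ 2 * C) : Integrable (fun e => e ^ 2 * Real.exp (|2 * d / Ξ| * |e|)) ν :=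
  h.integrable_sq_mul_exp hΞ.Γ_pos.le (abs_nonneg _)
    ((hΞ.abs_mul_scale_le hd).trans_lt (by norm_num))

theorem integral_sq_mul_exp_scale_le (h : HasBernsteinMoments ν σ Γ)
    (hΞ : IsTemperature C σ Γ Ξ) (hd : |d| ≤ 2 * C) :
    (2 * d / Ξ) ^ 2 / 2 * ∫ e, e ^ 2 * Real.exp (|2 * d / Ξ| * |e|) ∂ν ≤ d ^ 2 / Ξ / 16 := by
  have hscale := hΞ.abs_mul_scale_le hd
  have hΞ0 := hΞ.pos
  calc _ ≤ (2 * d / Ξ) ^ 2 / 2 * (σ ^ 2 / (1 - |2 * d / Ξ| * Γ) ^ 3) := by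
        gcongr
        exact h.integral_sq_mul_exp_le hΞ.Γ_pos.le (abs_nonneg _)
          (hscale.trans_lt (by norm_num))
    _ ≤ (2 * d / Ξ) ^ 2 / 2 * (σ ^ 2 / (1 / 2) ^ 3) := by
        gcongr
        linarith
    _ = d ^ 2 / Ξ * (16 * (σ ^ 2 / Ξ)) := by
        field_simp
        ring
    _ ≤ d ^ 2 / Ξ * (16 * (1 / 256)) := by
        have hσ := hΞ.variance_div_le
        gcongr d ^ 2 / Ξ * (16 * ?_)
    _ = d ^ 2 / Ξ / 16 := by ring

variable [IsProbabilityMeasure ν] [ν.IsNegInvariant]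

theorem lintegral_residualWeight_sub_div_le (h : HasBernsteinMoments ν σ Γ)
    (hΞ : IsTemperature C σ Γ Ξ) (ha : 0 ≤ a) (ha1 : a ≤ 1) (hd : |d| ≤ 2 * C) :
    ∫⁻ e, ENNReal.ofReal (residualWeight Ξ a (e - d) / residualWeight Ξ a e) ∂ν
      ≤ ENNReal.ofReal (1 - d ^ 2 / (4 * Ξ)) := by
  have hint := h.integrable_sq_mul_exp_scale hΞ hd
  have hintSq := h.integrable_sq
  refine (lintegral_le_of_add_neg_le (by fun_prop)
    (fun e => (div_pos (residualWeight_pos ha _) (residualWeight_pos ha _)).le) (by fun_prop)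
    (residualWeight_sub_div_add_neg_le hΞ.pos.le ha ha1 d)).trans (ENNReal.ofReal_le_ofReal ?_)
  rw [integral_add (by fun_prop) (by fun_prop), integral_add (by fun_prop) (by fun_prop),
    integral_const_mul, integral_const_mul, integral_const, probReal_univ, one_smul]
  have hΞ0 := hΞ.pos
  have ht8 := hΞ.sq_div_le hd
  rw [show d ^ 2 / (4 * Ξ) = d ^ 2 / Ξ / 4 by field_simp]
  have hexp_term := h.integral_sq_mul_exp_scale_le hΞ hd
  set t := d ^ 2 / Ξ
  have ht0 : 0 ≤ t := by positivity
  have hq_upper : 1 - Real.exp (-t) ≤ t := by linarith [Real.one_sub_le_exp_neg t]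
  have hq_lower : 7 / 8 * t ≤ 1 - Real.exp (-t) := by
    have htaylor := Real.abs_exp_sub_one_sub_id_le (x := -t)
      (by rw [abs_neg, abs_of_nonneg ht0]; linarith)
    nlinarith [(abs_le.1 htaylor).2]
  have hsq_term : (1 - Real.exp (-t)) / (2 * Ξ) * ∫ e, e ^ 2 ∂ν ≤ t / 512 := by
    calc _ ≤ t / (2 * Ξ) * σ ^ 2 := by
          gcongr
          exact h.integral_sq_le
      _ = t * (σ ^ 2 / Ξ) / 2 := by ring
      _ ≤ t * (1 / 256) / 2 := by
          have hσ := hΞ.variance_div_le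
          gcongr t * ?_ / 2
      _ = t / 512 := by ring
  linarith

theorem lintegral_residualWeight_div_sub_le (h : HasBernsteinMoments ν σ Γ)
    (hΞ : IsTemperature C σ Γ Ξ) (ha : 0 ≤ a) (hd : |d| ≤ 2 * C) :
    ∫⁻ e, ENNReal.ofReal (residualWeight Ξ a e / residualWeight Ξ a (e - d)) ∂ν
      ≤ ENNReal.ofReal (1 + 3 * d ^ 2 / (2 * Ξ)) := by
  have hint := h.integrable_sq_mul_exp_scale hΞ hd
  refine (lintegral_le_of_add_neg_le (by fun_prop)
    (fun e => (div_pos (residualWeight_pos ha _) (residualWeight_pos ha _)).le) (by fun_prop)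
    (residualWeight_div_sub_add_neg_le hΞ.pos.le ha d)).trans (ENNReal.ofReal_le_ofReal ?_)
  rw [integral_const_mul, integral_add (by fun_prop) (by fun_prop), integral_const_mul,
    integral_const, probReal_univ, one_smul]
  have hΞ0 := hΞ.pos
  have ht8 := hΞ.sq_div_le hd
  rw [show 3 * d ^ 2 / (2 * Ξ) = 3 / 2 * (d ^ 2 / Ξ) by field_simp]
  have hexp_term := h.integral_sq_mul_exp_scale_le hΞ hd
  set t := d ^ 2 / Ξ
  have ht0 : 0 ≤ t := by positivity
  have hexp : Real.exp t ≤ 1 + 9 / 8 * t := by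
    have htaylor := Real.abs_exp_sub_one_sub_id_le (x := t)
      (by rw [abs_of_nonneg ht0]; linarith)
    nlinarith [(abs_le.1 htaylor).2]
  calc _ ≤ (1 + 9 / 8 * t) * (1 + t / 16) := by gcongr
    _ ≤ 1 + 3 / 2 * t := by nlinarith

end HasBernsteinMoments

/-! ### A single observation -/

/-- The squared `L²(μ)`-distance. -/
noncomputable def sqDist {E : Type*} [MeasurableSpace E] (μ : Measure E) (f h : E → ℝ) : ℝ :=
  ∫ x, (h x - f x) ^ 2 ∂μ

section SqDist

variable {E : Type*} [MeasurableSpace E] {μ : Measure E} {f h : E → ℝ} {C : ℝ}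

theorem sqDist_nonneg (μ : Measure E) (f h : E → ℝ) : 0 ≤ sqDist μ f h :=
  integral_nonneg fun _ => sq_nonneg _

theorem abs_sub_le_two_mul {x y C : ℝ} (hx : |x| ≤ C) (hy : |y| ≤ C) : |x - y| ≤ 2 * C :=
  (abs_sub x y).trans (by linarith)

theorem integrable_sq_sub [IsFiniteMeasure μ] (hf : Measurable f) (hh : Measurable h)
    (hfC : ∀ᵐ x ∂μ, |f x| ≤ C) (hhC : ∀ᵐ x ∂μ, |h x| ≤ C) :
    Integrable (fun x => (h x - f x) ^ 2) μ := by
  refine Integrable.of_bound (by fun_prop) ((2 * C) ^ 2) ?_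
  filter_upwards [hfC, hhC] with x hfx hhx
  rw [norm_pow]
  exact pow_le_pow_left₀ (norm_nonneg _) (abs_sub_le_two_mul hhx hfx) 2

theorem lintegral_one_add_le_exp_integral [IsProbabilityMeasure μ] {u : E → ℝ}
    (hu : Integrable u μ) (hu0 : ∀ᵐ x ∂μ, 0 ≤ 1 + u x) :
    ∫⁻ x, ENNReal.ofReal (1 + u x) ∂μ ≤ ENNReal.ofReal (Real.exp (∫ x, u x ∂μ)) := by
  rw [← ofReal_integral_eq_lintegral_ofReal (by fun_prop) hu0,
    integral_add (integrable_const 1) hu, integral_const, probReal_univ, one_smul, add_comm]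
  exact ENNReal.ofReal_le_ofReal (Real.add_one_le_exp _)

end SqDist

/-- A regular conditional distribution of the noise `Y - f(X)` given `X`. -/
noncomputable def noiseKernel {Ω : Type*} [MeasurableSpace Ω] {p : ℕ} (P : Measure Ω)
    [IsProbabilityMeasure P] (X : Ω → EuclideanSpace ℝ (Fin p)) (Y : Ω → ℝ)
    (f : EuclideanSpace ℝ (Fin p) → ℝ) : Kernel (EuclideanSpace ℝ (Fin p)) ℝ :=
  condDistrib (fun ω => Y ω - f (X ω)) X P

instance isMarkovKernel_noiseKernel {Ω : Type*} [MeasurableSpace Ω] {p : ℕ} {P : Measure Ω}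
    [IsProbabilityMeasure P] {X : Ω → EuclideanSpace ℝ (Fin p)} {Y : Ω → ℝ}
    {f : EuclideanSpace ℝ (Fin p) → ℝ} : IsMarkovKernel (noiseKernel P X Y f) := by
  unfold noiseKernel
  infer_instance

namespace IsBoundedRegression

variable {Ω : Type*} [MeasurableSpace Ω] {p : ℕ} {P : Measure Ω} [IsProbabilityMeasure P]
  {X : Ω → EuclideanSpace ℝ (Fin p)} {Y : Ω → ℝ} {f h : EuclideanSpace ℝ (Fin p) → ℝ}
  {C K σ Γ Ξ a : ℝ}

theorem measurable_noise (H : IsBoundedRegression P X Y f C K σ Γ) :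
    Measurable (fun ω => Y ω - f (X ω)) :=
  H.measurable_Y.sub (H.measurable_f.comp H.measurable_X)

theorem isProbabilityMeasure_map (H : IsBoundedRegression P X Y f C K σ Γ) :
    IsProbabilityMeasure (P.map X) :=
  Measure.isProbabilityMeasure_map H.measurable_X.aemeasurable

theorem ae_abs_sub_le (H : IsBoundedRegression P X Y f C K σ Γ)
    (hhC : ∀ᵐ x ∂(P.map X), |h x| ≤ C) : ∀ᵐ x ∂(P.map X), |h x - f x| ≤ 2 * C := by
  filter_upwards [H.bounded, hhC] with x hfx hhx using abs_sub_le_two_mul hhx hfx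

theorem ae_lintegral_pow_noiseKernel_le (H : IsBoundedRegression P X Y f C K σ Γ) {k : ℕ}
    (hk : 2 ≤ k) :
    ∀ᵐ x ∂(P.map X), ∫⁻ e, ENNReal.ofReal (|e| ^ k) ∂(noiseKernel P X Y f x)
      ≤ ENNReal.ofReal (k.factorial / 2 * σ ^ 2 * Γ ^ (k - 2)) := by
  have hX := H.measurable_X
  have hnoise := H.measurable_noise
  have hint : Integrable (fun z : EuclideanSpace ℝ (Fin p) × ℝ => |z.2| ^ k)
      (P.map fun ω => (X ω, Y ω - f (X ω))) := by
    rw [integrable_map_measure (by fun_prop) (by fun_prop)]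
    exact H.integrable_moments k hk
  rw [ae_map_iff hX.aemeasurable
    (measurableSet_le (Measurable.lintegral_kernel (by fun_prop)) measurable_const)]
  filter_upwards [H.conditional_moments k hk,
    condExp_ae_eq_integral_condDistrib hX hnoise.aemeasurable
      (f := fun e : ℝ => |e| ^ k) (by fun_prop) (H.integrable_moments k hk),
    hint.condDistrib_ae hX.aemeasurable hnoise.aemeasurable] with ω hmoment hcond hintω
  rw [noiseKernel,
    ← ofReal_integral_eq_lintegral_ofReal hintω (ae_of_all _ fun e => by positivity), ← hcond]
  exact ENNReal.ofReal_le_ofReal hmoment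

theorem ae_hasBernsteinMoments (H : IsBoundedRegression P X Y f C K σ Γ) :
    ∀ᵐ x ∂(P.map X), HasBernsteinMoments (noiseKernel P X Y f x) σ Γ :=
  ae_all_iff.2 fun _ =>
    Filter.eventually_imp_distrib_left.2 fun hk => H.ae_lintegral_pow_noiseKernel_le hk

theorem ae_isNegInvariant (H : IsBoundedRegression P X Y f C K σ Γ) :
    ∀ᵐ x ∂(P.map X), (noiseKernel P X Y f x).IsNegInvariant :=
  H.conditional_symmetry.mono fun _ hx => ⟨hx⟩

theorem lintegral_observation (H : IsBoundedRegression P X Y f C K σ Γ)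
    {F : EuclideanSpace ℝ (Fin p) × ℝ → ℝ≥0∞} (hF : Measurable F) :
    ∫⁻ z, F z ∂(P.map fun ω => (X ω, Y ω))
      = ∫⁻ x, ∫⁻ e, F (x, f x + e) ∂(noiseKernel P X Y f x) ∂(P.map X) := by
  have hf := H.measurable_f
  have hshift : Measurable fun z : EuclideanSpace ℝ (Fin p) × ℝ => F (z.1, f z.1 + z.2) := by
    fun_prop
  rw [← Measure.lintegral_compProd hshift, noiseKernel,
    compProd_map_condDistrib H.measurable_noise.aemeasurable,
    lintegral_map hshift (H.measurable_X.prodMk H.measurable_noise),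
    lintegral_map hF (H.measurable_X.prodMk H.measurable_Y)]
  simp only [add_sub_cancel]

theorem lintegral_residualWeight_div_le (H : IsBoundedRegression P X Y f C K σ Γ)
    (hΞ : IsTemperature C σ Γ Ξ) (ha : 0 ≤ a) (ha1 : a ≤ 1) (hh : Measurable h)
    (hhC : ∀ᵐ x ∂(P.map X), |h x| ≤ C) :
    ∫⁻ z, ENNReal.ofReal (residualWeight Ξ a (z.2 - h z.1) / residualWeight Ξ a (z.2 - f z.1))
        ∂(P.map fun ω => (X ω, Y ω))
      ≤ ENNReal.ofReal (Real.exp (-(sqDist (P.map X) f h / (4 * Ξ)))) := by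
  have hf := H.measurable_f
  have := H.isProbabilityMeasure_map
  have hint := integrable_sq_sub hf hh H.bounded hhC
  have hnonneg : ∀ᵐ x ∂(P.map X), 0 ≤ 1 + -((h x - f x) ^ 2 / (4 * Ξ)) := by
    filter_upwards [H.ae_abs_sub_le hhC] with x hx
    have hsq := hΞ.sq_div_le hx
    rw [mul_comm, ← div_div]
    linarith
  rw [H.lintegral_observation (by fun_prop)]
  calc _ ≤ ∫⁻ x, ENNReal.ofReal (1 + -((h x - f x) ^ 2 / (4 * Ξ))) ∂(P.map X) := by
        refine lintegral_mono_ae ?_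
        filter_upwards [H.ae_hasBernsteinMoments, H.ae_isNegInvariant, H.ae_abs_sub_le hhC]
          with x hmoments _ hx
        rw [← sub_eq_add_neg]
        convert hmoments.lintegral_residualWeight_sub_div_le hΞ ha ha1 hx using 6 <;> ring
    _ ≤ _ := lintegral_one_add_le_exp_integral (by fun_prop) hnonneg
    _ = _ := by rw [integral_neg, integral_div, sqDist]

theorem lintegral_residualWeight_div_inv_le (H : IsBoundedRegression P X Y f C K σ Γ)
    (hΞ : IsTemperature C σ Γ Ξ) (ha : 0 ≤ a) (hh : Measurable h)
    (hhC : ∀ᵐ x ∂(P.map X), |h x| ≤ C) :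
    ∫⁻ z, ENNReal.ofReal (residualWeight Ξ a (z.2 - f z.1) / residualWeight Ξ a (z.2 - h z.1))
        ∂(P.map fun ω => (X ω, Y ω))
      ≤ ENNReal.ofReal (Real.exp (3 * sqDist (P.map X) f h / (2 * Ξ))) := by
  have hf := H.measurable_f
  have := H.isProbabilityMeasure_map
  have hint := integrable_sq_sub hf hh H.bounded hhC
  have hΞ0 := hΞ.pos
  rw [H.lintegral_observation (by fun_prop)]
  calc _ ≤ ∫⁻ x, ENNReal.ofReal (1 + 3 * (h x - f x) ^ 2 / (2 * Ξ)) ∂(P.map X) := by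
        refine lintegral_mono_ae ?_
        filter_upwards [H.ae_hasBernsteinMoments, H.ae_isNegInvariant, H.ae_abs_sub_le hhC]
          with x hmoments _ hx
        convert hmoments.lintegral_residualWeight_div_sub_le hΞ ha hx using 6 <;> ring
    _ ≤ _ := lintegral_one_add_le_exp_integral (by fun_prop)
        (ae_of_all _ fun x => by positivity)
    _ = _ := by rw [integral_div, integral_const_mul, sqDist]

theorem integral_mul_noise_eq_zero (H : IsBoundedRegression P X Y f C K σ Γ)
    {g : EuclideanSpace ℝ (Fin p) → ℝ} (hg : Measurable g)
    (hint : Integrable (fun ω => g (X ω) * (Y ω - f (X ω))) P) :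
    ∫ ω, g (X ω) * (Y ω - f (X ω)) ∂P = 0 := by
  have hgX : StronglyMeasurable[MeasurableSpace.comap X inferInstance] fun ω => g (X ω) :=
    (hg.comp (comap_measurable X)).stronglyMeasurable
  rw [← integral_condExp H.measurable_X.comap_le]
  refine integral_eq_zero_of_ae ?_
  filter_upwards [condExp_mul_of_stronglyMeasurable_left hgX hint H.integrable_noise,
    H.condExp_noise] with ω hpull hnoise
  refine hpull.trans ?_
  rw [Pi.mul_apply, hnoise, Pi.zero_apply, mul_zero]

theorem excessRisk_eq_sqDist (H : IsBoundedRegression P X Y f C K σ Γ) (hh : Measurable h)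
    (hhC : ∀ᵐ x ∂(P.map X), |h x| ≤ C) :
    excessRisk P X Y f h = sqDist (P.map X) f h := by
  have hf := H.measurable_f
  have hX := H.measurable_X
  have := H.isProbabilityMeasure_map
  have hsq : Integrable (fun ω => (h (X ω) - f (X ω)) ^ 2) P := by
    have hint := integrable_sq_sub hf hh H.bounded hhC
    rwa [integrable_map_measure (by fun_prop) hX.aemeasurable] at hint
  have hcross : Integrable (fun ω => (h (X ω) - f (X ω)) * (Y ω - f (X ω))) P :=
    H.integrable_noise.bdd_mul (by fun_prop)
      (ae_of_ae_map hX.aemeasurable (H.ae_abs_sub_le hhC))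
  have hnoise : Integrable (fun ω => (Y ω - f (X ω)) ^ 2) P := by
    simpa only [sq_abs] using H.integrable_moments 2 le_rfl
  have hrisk : risk P X Y h = risk P X Y f + ∫ ω, (h (X ω) - f (X ω)) ^ 2 ∂P := by
    calc risk P X Y h = ∫ ω, ((Y ω - f (X ω)) ^ 2 + (h (X ω) - f (X ω)) ^ 2
          - 2 * ((h (X ω) - f (X ω)) * (Y ω - f (X ω)))) ∂P :=
          integral_congr_ae (ae_of_all _ fun ω => by ring)
      _ = _ := by
          rw [integral_sub (by fun_prop) (by fun_prop), integral_add hnoise hsq,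
            integral_const_mul,
            H.integral_mul_noise_eq_zero (g := fun x => h x - f x) (by fun_prop) hcross,
            mul_zero, sub_zero, risk]
  rw [excessRisk, hrisk, sqDist, integral_map hX.aemeasurable (by fun_prop), add_sub_cancel_left]

end IsBoundedRegression

/-! ### A PAC-Bayes bound for product likelihoods -/

section PACBayes

theorem measure_ofReal_div_le_le {T : Type*} [MeasurableSpace T] {ν : Measure T} {u : T → ℝ≥0∞}
    (hu : AEMeasurable u ν) {x η : ℝ} (hx : 0 < x) (hη : 0 < η)
    (hle : ∫⁻ d, u d ∂ν ≤ ENNReal.ofReal x) :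
    ν {d | ENNReal.ofReal (x / η) ≤ u d} ≤ ENNReal.ofReal η := by
  have hthreshold : 0 < x / η := div_pos hx hη
  calc ν {d | ENNReal.ofReal (x / η) ≤ u d} ≤ (∫⁻ d, u d ∂ν) / ENNReal.ofReal (x / η) :=
        meas_ge_le_lintegral_div hu (ENNReal.ofReal_pos.2 hthreshold).ne' ENNReal.ofReal_ne_top
    _ ≤ ENNReal.ofReal x / ENNReal.ofReal (x / η) := by gcongr
    _ = ENNReal.ofReal η := by rw [← ENNReal.ofReal_div_of_pos hthreshold, div_div_cancel₀ hx.ne']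

theorem two_le_add_inv {x : ℝ} (hx : 0 < x) : 2 ≤ x + x⁻¹ := by
  have hsq : x + x⁻¹ - 2 = (x - 1) ^ 2 / x := by
    field_simp
    ring
  have : 0 ≤ (x - 1) ^ 2 / x := by positivity
  linarith

theorem sq_measureReal_div_le_integral {T : Type*} [MeasurableSpace T] {π : Measure T}
    [IsFiniteMeasure π] {h : T → ℝ} (hh0 : ∀ θ, 0 < h θ) (hh : Integrable h π) {S : Set T}
    {A : ℝ} (hS : 0 < π.real S) (hA : 0 < A)
    (hle : ∫⁻ θ in S, ENNReal.ofReal (h θ)⁻¹ ∂π ≤ ENNReal.ofReal A) :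
    π.real S ^ 2 / A ≤ ∫ θ, h θ ∂π := by
  set m := π.real S
  set t := A / m with ht
  have ht0 : 0 < t := by positivity
  have hint0 : 0 ≤ ∫ θ, h θ ∂π := integral_nonneg fun θ => (hh0 θ).le
  -- The scale `t` balances the two terms of `2 ≤ t h + (t h)⁻¹`, integrated over `S`.
  have hpointwise : ∀ θ, ENNReal.ofReal 2 ≤ ENNReal.ofReal (t * h θ)
      + ENNReal.ofReal t⁻¹ * ENNReal.ofReal (h θ)⁻¹ := fun θ => by
    have hth : 0 < t * h θ := mul_pos ht0 (hh0 θ)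
    rw [← ENNReal.ofReal_mul (by positivity), ← mul_inv,
      ← ENNReal.ofReal_add hth.le (by positivity)]
    exact ENNReal.ofReal_le_ofReal (two_le_add_inv hth)
  have hintegrated : ENNReal.ofReal (2 * m) ≤ ENNReal.ofReal (t * ∫ θ, h θ ∂π + m) := by
    calc ENNReal.ofReal (2 * m) = ∫⁻ _ in S, ENNReal.ofReal 2 ∂π := by
          rw [setLIntegral_const, ENNReal.ofReal_mul zero_le_two, ofReal_measureReal]
      _ ≤ ∫⁻ θ in S, (ENNReal.ofReal (t * h θ)
          + ENNReal.ofReal t⁻¹ * ENNReal.ofReal (h θ)⁻¹) ∂π := lintegral_mono hpointwise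
      _ = ∫⁻ θ in S, ENNReal.ofReal (t * h θ) ∂π
          + ENNReal.ofReal t⁻¹ * ∫⁻ θ in S, ENNReal.ofReal (h θ)⁻¹ ∂π := by
          rw [lintegral_add_left' (hh.const_mul t).1.aemeasurable.ennreal_ofReal.restrict,
            lintegral_const_mul' _ _ ENNReal.ofReal_ne_top]
      _ ≤ ∫⁻ θ, ENNReal.ofReal (t * h θ) ∂π + ENNReal.ofReal t⁻¹ * ENNReal.ofReal A := by
          gcongr
          exact Measure.restrict_le_self
      _ = ENNReal.ofReal (t * ∫ θ, h θ ∂π + m) := by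
          rw [← ofReal_integral_eq_lintegral_ofReal (hh.const_mul t)
            (ae_of_all _ fun θ => (mul_pos ht0 (hh0 θ)).le), integral_const_mul,
            ← ENNReal.ofReal_mul (by positivity),
            ← ENNReal.ofReal_add (by positivity) (by positivity), ht, inv_div,
            div_mul_cancel₀ _ hA.ne']
  rw [ENNReal.ofReal_le_ofReal_iff (by positivity), ht, div_mul_eq_mul_div] at hintegrated
  have hm_le : m ≤ A * (∫ θ, h θ ∂π) / m := by linarith
  rw [le_div_iff₀ hS] at hm_le
  rw [div_le_iff₀ hA]
  linarith

variable {ι T Z : Type*} [Fintype ι]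

/-- The likelihood of the parameter `θ` for independent data `d`, where `g θ z` is the (not
necessarily normalized) likelihood of a single observation `z`. -/
noncomputable def likelihood (g : T → Z → ℝ) (d : ι → Z) (θ : T) : ℝ := ∏ i, g θ (d i)

/-- The posterior with prior `π` and density proportional to `likelihood g d`. -/
noncomputable def likelihoodPosterior [MeasurableSpace T] (π : Measure T) (g : T → Z → ℝ)
    (d : ι → Z) : Measure T :=
  π.tilted fun θ => ∑ i, Real.log (g θ (d i))

variable {g : T → Z → ℝ}

theorem likelihood_pos (hg0 : ∀ θ z, 0 < g θ z) (d : ι → Z) (θ : T) : 0 < likelihood g d θ :=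
  Finset.prod_pos fun i _ => hg0 θ (d i)

theorem likelihood_inv (g : T → Z → ℝ) (d : ι → Z) (θ : T) :
    likelihood (fun θ z => (g θ z)⁻¹) d θ = (likelihood g d θ)⁻¹ :=
  Finset.prod_inv_distrib _

theorem exp_sum_log_eq_likelihood (hg0 : ∀ θ z, 0 < g θ z) (d : ι → Z) (θ : T) :
    Real.exp (∑ i, Real.log (g θ (d i))) = likelihood g d θ := by
  rw [Real.exp_sum, likelihood]
  exact Finset.prod_congr rfl fun i _ => Real.exp_log (hg0 θ (d i))

variable [MeasurableSpace T] {π : Measure T}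

theorem isProbabilityMeasure_likelihoodPosterior [NeZero π] (hg0 : ∀ θ z, 0 < g θ z) {d : ι → Z}
    (hint : Integrable (likelihood g d) π) : IsProbabilityMeasure (likelihoodPosterior π g d) := by
  refine isProbabilityMeasure_tilted ?_
  simp_rw [exp_sum_log_eq_likelihood hg0]
  exact hint

theorem likelihoodPosterior_div (hg0 : ∀ θ z, 0 < g θ z) {r : Z → ℝ} (hr0 : ∀ z, 0 < r z)
    (d : ι → Z) :
    likelihoodPosterior π (fun θ z => g θ z / r z) d = likelihoodPosterior π g d := by
  have hlog : ∀ θ, ∑ i, Real.log (g θ (d i) / r (d i))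
      = ∑ i, Real.log (g θ (d i)) + -∑ i, Real.log (r (d i)) := fun θ => by
    rw [← sub_eq_add_neg, ← Finset.sum_sub_distrib]
    exact Finset.sum_congr rfl fun i _ => Real.log_div (hg0 θ (d i)).ne' (hr0 (d i)).ne'
  ext s hs
  simp only [likelihoodPosterior, hlog, tilted_apply' _ _ hs, Real.exp_add, integral_mul_const,
    mul_div_mul_right _ _ (Real.exp_ne_zero _)]

theorem lintegral_likelihoodPosterior_le [IsFiniteMeasure π] (hg0 : ∀ θ z, 0 < g θ z)
    {d : ι → Z} (hint : Integrable (likelihood g d) π) {S : Set T} {A : ℝ} (hS : 0 < π.real S)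
    (hA : 0 < A) (hle : ∫⁻ θ in S, ENNReal.ofReal (likelihood g d θ)⁻¹ ∂π ≤ ENNReal.ofReal A)
    (k : T → ℝ≥0∞) :
    ∫⁻ θ, k θ ∂(likelihoodPosterior π g d)
      ≤ ENNReal.ofReal (A / π.real S ^ 2)
        * ∫⁻ θ, k θ * ENNReal.ofReal (likelihood g d θ) ∂π := by
  have hnormalizer := sq_measureReal_div_le_integral (likelihood_pos hg0 d) hint hS hA hle
  rw [likelihoodPosterior, lintegral_tilted, ← lintegral_const_mul' _ _ ENNReal.ofReal_ne_top]
  simp only [exp_sum_log_eq_likelihood hg0]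
  refine lintegral_mono fun θ => ?_
  rw [mul_left_comm, mul_comm (k θ), ← ENNReal.ofReal_mul (by positivity)]
  gcongr
  rw [div_eq_inv_mul, ← inv_div]
  have := (likelihood_pos hg0 d θ).le
  gcongr

variable [MeasurableSpace Z]

theorem measurable_uncurry_likelihood (hg : Measurable (Function.uncurry g)) :
    Measurable fun x : (ι → Z) × T => likelihood g x.1 x.2 :=
  Finset.measurable_prod _ fun i _ =>
    hg.comp (measurable_snd.prodMk ((measurable_pi_apply i).comp measurable_fst))

theorem integrable_likelihood {π : Measure T} [IsFiniteMeasure π] {M : ℝ}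
    (hg : Measurable (Function.uncurry g)) (hg0 : ∀ θ z, 0 < g θ z) (hgM : ∀ θ z, g θ z ≤ M)
    (d : ι → Z) : Integrable (likelihood g d) π := by
  refine Integrable.of_bound (C := M ^ Fintype.card ι)
    ((measurable_uncurry_likelihood hg).comp measurable_prodMk_left).aestronglyMeasurable
    (ae_of_all _ fun θ => ?_)
  rw [Real.norm_of_nonneg (likelihood_pos hg0 d θ).le, ← Finset.card_univ, ← Finset.prod_const]
  exact Finset.prod_le_prod (fun i _ => (hg0 θ (d i)).le) fun i _ => hgM θ (d i)

theorem lintegral_ofReal_likelihood (Q : Measure Z) [IsProbabilityMeasure Q]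
    (hg : Measurable (Function.uncurry g)) (hg0 : ∀ θ z, 0 < g θ z) (θ : T) :
    ∫⁻ d, ENNReal.ofReal (likelihood g d θ) ∂(Measure.pi fun _ : ι => Q)
      = (∫⁻ z, ENNReal.ofReal (g θ z) ∂Q) ^ Fintype.card ι := by
  have hgθ : Measurable fun z => ENNReal.ofReal (g θ z) :=
    (hg.comp measurable_prodMk_left).ennreal_ofReal
  have hindep : iIndepFun (fun (i : ι) (d : ι → Z) => ENNReal.ofReal (g θ (d i)))
      (Measure.pi fun _ : ι => Q) :=
    iIndepFun_pi (X := fun _ z => ENNReal.ofReal (g θ z)) fun _ => hgθ.aemeasurable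
  simp only [likelihood, ENNReal.ofReal_prod_of_nonneg fun _ _ => (hg0 θ _).le]
  rw [lintegral_prod_eq_prod_lintegral_of_indepFun Finset.univ _ hindep fun i => by fun_prop]
  simp only [(measurePreserving_eval (fun _ : ι => Q) _).lintegral_comp hgθ, Finset.prod_const,
    Finset.card_univ]

theorem measurable_lintegral_mul_likelihood [SFinite π] (hg : Measurable (Function.uncurry g))
    {k : T → ℝ≥0∞} (hk : Measurable k) :
    Measurable fun d : ι → Z => ∫⁻ θ, k θ * ENNReal.ofReal (likelihood g d θ) ∂π :=
  ((hk.comp measurable_snd).mul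
    (measurable_uncurry_likelihood hg).ennreal_ofReal).lintegral_prod_right'

theorem lintegral_lintegral_mul_likelihood [SFinite π] (Q : Measure Z) [IsProbabilityMeasure Q]
    (hg : Measurable (Function.uncurry g)) (hg0 : ∀ θ z, 0 < g θ z) {k : T → ℝ≥0∞}
    (hk : Measurable k) :
    ∫⁻ d, ∫⁻ θ, k θ * ENNReal.ofReal (likelihood g d θ) ∂π ∂(Measure.pi fun _ : ι => Q)
      = ∫⁻ θ, k θ * (∫⁻ z, ENNReal.ofReal (g θ z) ∂Q) ^ Fintype.card ι ∂π := by
  have hjoint : Measurable fun x : (ι → Z) × T => ENNReal.ofReal (likelihood g x.1 x.2) :=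
    (measurable_uncurry_likelihood hg).ennreal_ofReal
  rw [lintegral_lintegral_swap ((hk.comp measurable_snd).mul hjoint).aemeasurable]
  refine lintegral_congr fun θ => ?_
  have hθ : Measurable fun d : ι → Z => ENNReal.ofReal (likelihood g d θ) :=
    hjoint.comp measurable_prodMk_right
  rw [lintegral_const_mul _ hθ, lintegral_ofReal_likelihood Q hg hg0]

/-- The two factors `2 / δ` come from Markov's inequality, applied to the numerator of the posterior
integral and to the inverse likelihood that controls its denominator. -/
theorem measure_not_lintegral_likelihoodPosterior_le_le [IsFiniteMeasure π] (Q : Measure Z)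
    [IsProbabilityMeasure Q] (hg : Measurable (Function.uncurry g)) (hg0 : ∀ θ z, 0 < g θ z)
    (hint : ∀ d : ι → Z, Integrable (likelihood g d) π) {S : Set T} (hS : 0 < π.real S)
    {k : T → ℝ≥0∞} (hk : Measurable k) {A J : ℝ} (hA : 0 < A) (hJ : 0 < J)
    (hkJ : ∫⁻ θ, k θ * (∫⁻ z, ENNReal.ofReal (g θ z) ∂Q) ^ Fintype.card ι ∂π ≤ ENNReal.ofReal J)
    (hSA : ∫⁻ θ in S, (∫⁻ z, ENNReal.ofReal (g θ z)⁻¹ ∂Q) ^ Fintype.card ι ∂π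
      ≤ ENNReal.ofReal A) {δ : ℝ} (hδ : 0 < δ) :
    (Measure.pi fun _ : ι => Q) {d | ¬ ∫⁻ θ, k θ ∂(likelihoodPosterior π g d)
        ≤ ENNReal.ofReal ((2 / δ) ^ 2 * (A * J / π.real S ^ 2))} ≤ ENNReal.ofReal δ := by
  have hginv : Measurable (Function.uncurry fun θ z => (g θ z)⁻¹) := hg.inv
  have hginv0 : ∀ θ z, 0 < (g θ z)⁻¹ := fun θ z => inv_pos.2 (hg0 θ z)
  let numerator : (ι → Z) → ℝ≥0∞ := fun d => ∫⁻ θ, k θ * ENNReal.ofReal (likelihood g d θ) ∂π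
  let inverseMass : (ι → Z) → ℝ≥0∞ :=
    fun d => ∫⁻ θ in S, 1 * ENNReal.ofReal (likelihood (fun θ z => (g θ z)⁻¹) d θ) ∂π
  have hnumerator : (Measure.pi fun _ : ι => Q) {d | ENNReal.ofReal (J / (δ / 2)) ≤ numerator d}
      ≤ ENNReal.ofReal (δ / 2) :=
    measure_ofReal_div_le_le (measurable_lintegral_mul_likelihood hg hk).aemeasurable hJ
      (half_pos hδ) ((lintegral_lintegral_mul_likelihood Q hg hg0 hk).trans_le hkJ)
  have hinverse : (Measure.pi fun _ : ι => Q) {d | ENNReal.ofReal (A / (δ / 2)) ≤ inverseMass d}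
      ≤ ENNReal.ofReal (δ / 2) := by
    refine measure_ofReal_div_le_le
      (measurable_lintegral_mul_likelihood hginv measurable_const).aemeasurable hA
      (half_pos hδ) ?_
    rw [lintegral_lintegral_mul_likelihood Q hginv hginv0 measurable_const]
    simpa only [one_mul] using hSA
  have hsubset : {d | ¬ ∫⁻ θ, k θ ∂(likelihoodPosterior π g d)
        ≤ ENNReal.ofReal ((2 / δ) ^ 2 * (A * J / π.real S ^ 2))}
      ⊆ {d | ENNReal.ofReal (J / (δ / 2)) ≤ numerator d}
        ∪ {d | ENNReal.ofReal (A / (δ / 2)) ≤ inverseMass d} := by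
    intro d
    contrapose!
    simp only [Set.mem_union, Set.mem_ofPred_eq, not_or, not_le, not_lt]
    rintro ⟨hnum, hinv⟩
    simp only [inverseMass, likelihood_inv, one_mul] at hinv
    calc _ ≤ ENNReal.ofReal (A / (δ / 2) / π.real S ^ 2) * numerator d :=
          lintegral_likelihoodPosterior_le hg0 (hint d) hS (by positivity) hinv.le k
      _ ≤ ENNReal.ofReal (A / (δ / 2) / π.real S ^ 2) * ENNReal.ofReal (J / (δ / 2)) := by
          gcongr
      _ = _ := by
          rw [← ENNReal.ofReal_mul (by positivity)]
          congr 1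
          field_simp
  calc _ ≤ _ := measure_mono hsubset
    _ ≤ _ := measure_union_le _ _
    _ ≤ ENNReal.ofReal (δ / 2) + ENNReal.ofReal (δ / 2) := add_le_add hnumerator hinverse
    _ = ENNReal.ofReal δ := by
        rw [← ENNReal.ofReal_add (by positivity) (by positivity), add_halves]

end PACBayes

/-! ### Regularity of the networks -/

section Network

variable {p L r : ℕ}

theorem continuous_hidden (k : ℕ) (i : Fin r) :
    Continuous fun z : Param p L r × EuclideanSpace ℝ (Fin p) => hidden z.1 z.2 k i := by
  induction k generalizing i with
  | zero =>
    simp only [hidden]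
    fun_prop
  | succ k ih =>
    by_cases hk : k < L - 1
    · simp only [hidden, hk, dif_pos]
      fun_prop
    · simp only [hidden, hk, dif_neg, not_false_eq_true]
      fun_prop

theorem continuous_uncurry_clipped (C : ℝ) :
    Continuous fun z : Param p L r × EuclideanSpace ℝ (Fin p) => clipped C z.1 z.2 := by
  have := continuous_hidden (p := p) (L := L) (r := r) (L - 1)
  unfold clipped network
  fun_prop

theorem measurable_uncurry_clipped (C : ℝ) :
    Measurable fun z : Param p L r × EuclideanSpace ℝ (Fin p) => clipped C z.1 z.2 :=
  (continuous_uncurry_clipped C).measurable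

theorem measurable_clipped (C : ℝ) (θ : Param p L r) : Measurable (clipped C θ) :=
  (measurable_uncurry_clipped C).comp measurable_prodMk_left

theorem abs_clipped_le {C : ℝ} (hC : 0 ≤ C) (θ : Param p L r) (x : EuclideanSpace ℝ (Fin p)) :
    |clipped C θ x| ≤ C :=
  abs_le.2 ⟨le_max_left _ _, max_le (by linarith) (min_le_right _ _)⟩

theorem abs_clipped_sub_le (C : ℝ) (θ θ' : Param p L r) (x : EuclideanSpace ℝ (Fin p)) :
    |clipped C θ x - clipped C θ' x| ≤ |network θ x - network θ' x| := by
  unfold clipped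
  refine (abs_max_sub_max_le_max _ _ _ _).trans ?_
  rw [sub_self, abs_zero, max_eq_right (abs_nonneg _)]
  refine (abs_min_sub_min_le_max _ _ _ _).trans ?_
  rw [sub_self, abs_zero, max_eq_left (abs_nonneg _)]

theorem abs_max_zero_sub_le (a b : ℝ) : |max a 0 - max b 0| ≤ |a - b| := by
  simpa using abs_max_sub_max_le_max a 0 b 0

theorem abs_max_zero_le (a : ℝ) : |max a 0| ≤ |a| := by
  simpa using abs_max_zero_sub_le a 0

section Affine

variable {J : Type*} [Fintype J]

theorem abs_sum_mul_le {w h : J → ℝ} {B : ℝ} (hw : ∀ j, |w j| ≤ B) :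
    |∑ j, w j * h j| ≤ B * ∑ j, |h j| := by
  rw [Finset.mul_sum]
  refine (Finset.abs_sum_le_sum_abs _ _).trans (Finset.sum_le_sum fun j _ => ?_)
  rw [abs_mul]
  exact mul_le_mul_of_nonneg_right (hw j) (abs_nonneg _)

theorem abs_affine_le {w h : J → ℝ} {b B : ℝ} (hw : ∀ j, |w j| ≤ B) (hb : |b| ≤ B) :
    |(∑ j, w j * h j) + b| ≤ B * (1 + ∑ j, |h j|) := by
  linarith [abs_add_le (∑ j, w j * h j) b, abs_sum_mul_le (h := h) hw]

theorem abs_affine_sub_le {w w' h h' : J → ℝ} {b b' B δ : ℝ} (hw : ∀ j, |w j| ≤ B)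
    (hww' : ∀ j, |w j - w' j| ≤ δ) (hbb' : |b - b'| ≤ δ) :
    |((∑ j, w j * h j) + b) - ((∑ j, w' j * h' j) + b')|
      ≤ B * ∑ j, |h j - h' j| + δ * (1 + ∑ j, |h' j|) := by
  have hsplit : ((∑ j, w j * h j) + b) - ((∑ j, w' j * h' j) + b')
      = ∑ j, w j * (h j - h' j) + ((∑ j, (w j - w' j) * h' j) + (b - b')) := by
    simp only [mul_sub, sub_mul, Finset.sum_sub_distrib]
    ring
  rw [hsplit]
  exact (abs_add_le _ _).trans (add_le_add (abs_sum_mul_le hw) (abs_affine_le hww' hbb'))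

end Affine

theorem sum_le_nat_mul {h : Fin r → ℝ} {N : ℝ} (hh : ∀ j, h j ≤ N) : ∑ j, h j ≤ r * N := by
  simpa using Finset.sum_le_card_nsmul Finset.univ h N fun j _ => hh j

/-- The weight of an input `x` in the Lipschitz estimates for `θ ↦ network θ x`. -/
noncomputable def inputSize (x : EuclideanSpace ℝ (Fin p)) : ℝ := 1 + ∑ j, |x j|

theorem one_le_inputSize (x : EuclideanSpace ℝ (Fin p)) : 1 ≤ inputSize x :=
  le_add_of_nonneg_right (Finset.sum_nonneg fun _ _ => abs_nonneg _)

theorem sq_inputSize_le (x : EuclideanSpace ℝ (Fin p)) :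
    inputSize x ^ 2 ≤ 2 + 2 * p * ‖x‖ ^ 2 := by
  have hsum : (∑ j, |x j|) ^ 2 ≤ p * ‖x‖ ^ 2 := by
    have := sq_sum_le_card_mul_sum_sq (s := Finset.univ) (f := fun j => |x j|)
    rw [EuclideanSpace.norm_sq_eq]
    simpa using this
  unfold inputSize
  linarith [add_sq_le (a := 1) (b := ∑ j, |x j|)]

section Lipschitz

variable {B : ℝ} {θ θ' : Param p L r}

theorem abs_hidden_le (hrB : 1 ≤ r * B) (hB : 0 ≤ B) (hθ : ∀ i, |θ i| ≤ B)
    (x : EuclideanSpace ℝ (Fin p)) (k : ℕ) (i : Fin r) :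
    |hidden θ x k i| ≤ (k + 1) * inputSize x * B * (r * B) ^ k := by
  have hx := one_le_inputSize x
  induction k generalizing i with
  | zero =>
    simp only [hidden, CharP.cast_eq_zero, zero_add, one_mul, pow_zero, mul_one]
    rw [mul_comm]
    exact (abs_max_zero_le _).trans (abs_affine_le (fun _ => hθ _) (hθ _))
  | succ k ih =>
    by_cases hk : k < L - 1
    · simp only [hidden, hk, dif_pos]
      have hconst : B ≤ inputSize x * B * (r * B) ^ (k + 1) := by
        calc B = 1 * B * 1 := by ring
          _ ≤ _ := by
            gcongr
            exact one_le_pow₀ hrB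
      calc _ ≤ B * (1 + ∑ j, |hidden θ x k j|) :=
            (abs_max_zero_le _).trans (abs_affine_le (fun _ => hθ _) (hθ _))
        _ ≤ B * (1 + r * ((k + 1) * inputSize x * B * (r * B) ^ k)) := by
            gcongr
            exact sum_le_nat_mul ih
        _ = B + (k + 1) * (inputSize x * B * (r * B) ^ (k + 1)) := by ring
        _ ≤ _ := by
            push_cast
            linarith
    · simp only [hidden, hk, dif_neg, not_false_eq_true, abs_zero]
      positivity

theorem abs_hidden_sub_le {δ : ℝ} (hrB : 1 ≤ r * B) (hB : 0 ≤ B) (hθ : ∀ i, |θ i| ≤ B)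
    (hθ' : ∀ i, |θ' i| ≤ B) (hδ : ∀ i, |θ i - θ' i| ≤ δ) (hδ0 : 0 ≤ δ)
    (x : EuclideanSpace ℝ (Fin p)) (k : ℕ) (i : Fin r) :
    |hidden θ x k i - hidden θ' x k i|
      ≤ (k + 1) * (k + 2) / 2 * inputSize x * δ * (r * B) ^ k := by
  have hx := one_le_inputSize x
  induction k generalizing i with
  | zero =>
    simp only [hidden]
    refine (abs_max_zero_sub_le _ _).trans
      ((abs_affine_sub_le (fun _ => hθ _) (fun _ => hδ _) (hδ _)).trans_eq ?_)
    simp [inputSize, mul_comm]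
  | succ k ih =>
    by_cases hk : k < L - 1
    · simp only [hidden, hk, dif_pos]
      have hconst : δ ≤ inputSize x * δ * (r * B) ^ (k + 1) := by
        calc δ = 1 * δ * 1 := by ring
          _ ≤ _ := by
            gcongr
            exact one_le_pow₀ hrB
      calc _ ≤ B * ∑ j, |hidden θ x k j - hidden θ' x k j| + δ * (1 + ∑ j, |hidden θ' x k j|) :=
            (abs_max_zero_sub_le _ _).trans
              (abs_affine_sub_le (fun _ => hθ _) (fun _ => hδ _) (hδ _))
        _ ≤ B * (r * ((k + 1) * (k + 2) / 2 * inputSize x * δ * (r * B) ^ k))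
            + δ * (1 + r * ((k + 1) * inputSize x * B * (r * B) ^ k)) := by
            gcongr
            · exact sum_le_nat_mul ih
            · exact sum_le_nat_mul (abs_hidden_le hrB hB hθ' x k)
        _ = δ + ((k + 1) * (k + 2) / 2 + (k + 1)) * (inputSize x * δ * (r * B) ^ (k + 1)) := by
            ring
        _ ≤ _ := by
            push_cast
            linarith
    · simp only [hidden, hk, dif_neg, not_false_eq_true, sub_zero, abs_zero]
      positivity

theorem succ_mul_succ_half_le_two_pow (L : ℕ) : ((L : ℝ) + 1) * (L + 2) / 2 ≤ 2 * 2 ^ L := by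
  induction L with
  | zero => norm_num
  | succ k ih =>
    rcases Nat.eq_zero_or_pos k with rfl | hk
    · norm_num
    · have : (1 : ℝ) ≤ k := by exact_mod_cast hk
      push_cast
      rw [pow_succ]
      nlinarith

theorem abs_network_sub_le {δ : ℝ} (hrB : 1 ≤ r * B) (hB : 0 ≤ B) (hL : 1 ≤ L)
    (hθ : ∀ i, |θ i| ≤ B) (hθ' : ∀ i, |θ' i| ≤ B) (hδ : ∀ i, |θ i - θ' i| ≤ δ) (hδ0 : 0 ≤ δ)
    (x : EuclideanSpace ℝ (Fin p)) :
    |network θ x - network θ' x| ≤ 2 * (2 * r * B) ^ L * inputSize x * δ := by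
  have hx := one_le_inputSize x
  obtain ⟨k, rfl⟩ : ∃ k, L = k + 1 := ⟨L - 1, by omega⟩
  have hconst : δ ≤ inputSize x * δ * (r * B) ^ (k + 1) := by
    calc δ = 1 * δ * 1 := by ring
      _ ≤ _ := by
        gcongr
        exact one_le_pow₀ hrB
  unfold network
  calc _ ≤ B * ∑ j, |hidden θ x k j - hidden θ' x k j| + δ * (1 + ∑ j, |hidden θ' x k j|) :=
        abs_affine_sub_le (fun _ => hθ _) (fun _ => hδ _) (hδ _)
    _ ≤ B * (r * ((k + 1) * (k + 2) / 2 * inputSize x * δ * (r * B) ^ k))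
        + δ * (1 + r * ((k + 1) * inputSize x * B * (r * B) ^ k)) := by
        gcongr
        · exact sum_le_nat_mul (abs_hidden_sub_le hrB hB hθ hθ' hδ hδ0 x k)
        · exact sum_le_nat_mul (abs_hidden_le hrB hB hθ' x k)
    _ = δ + ((k + 1) * (k + 2) / 2 + (k + 1)) * (inputSize x * δ * (r * B) ^ (k + 1)) := by
        ring
    _ ≤ (((k + 1 : ℕ) : ℝ) + 1) * ((k + 1 : ℕ) + 2) / 2
        * (inputSize x * δ * (r * B) ^ (k + 1)) := by
        push_cast
        linarith
    _ ≤ 2 * 2 ^ (k + 1) * (inputSize x * δ * (r * B) ^ (k + 1)) := by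
        gcongr
        exact succ_mul_succ_half_le_two_pow (k + 1)
    _ = _ := by
        rw [mul_assoc 2 (r : ℝ) B, mul_pow 2 (r * B)]
        ring

theorem abs_le_of_mem_cube (hθ : θ ∈ cube p L r B) (i : ParamIndex p L r) : |θ i| ≤ B :=
  abs_le.2 ⟨hθ.1 i, hθ.2 i⟩

theorem sq_clipped_sub_le (hrB : 1 ≤ r * B) (hB : 0 ≤ B) (hL : 1 ≤ L) (hθ : θ ∈ cube p L r B)
    (hθ' : θ' ∈ cube p L r B) (C : ℝ) (x : EuclideanSpace ℝ (Fin p)) :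
    (clipped C θ x - clipped C θ' x) ^ 2
      ≤ 4 * ((2 * r * B) ^ L * ‖θ - θ'‖) ^ 2 * (2 + 2 * p * ‖x‖ ^ 2) := by
  have hlip : |clipped C θ x - clipped C θ' x| ≤ 2 * (2 * r * B) ^ L * inputSize x * ‖θ - θ'‖ :=
    (abs_clipped_sub_le C θ θ' x).trans <| abs_network_sub_le hrB hB hL (abs_le_of_mem_cube hθ)
      (abs_le_of_mem_cube hθ') (fun i => norm_le_pi_norm (θ - θ') i) (norm_nonneg _) x
  rw [← sq_abs]
  calc _ ≤ (2 * (2 * r * B) ^ L * inputSize x * ‖θ - θ'‖) ^ 2 := by gcongr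
    _ = 4 * ((2 * r * B) ^ L * ‖θ - θ'‖) ^ 2 * inputSize x ^ 2 := by ring
    _ ≤ _ := by
      gcongr
      exact sq_inputSize_le x

theorem sqDist_clipped_le {μ : Measure (EuclideanSpace ℝ (Fin p))} [IsProbabilityMeasure μ]
    {f : EuclideanSpace ℝ (Fin p) → ℝ} {C K : ℝ} (hf : Measurable f) (hfC : ∀ᵐ x ∂μ, |f x| ≤ C)
    (hC : 0 ≤ C) (hμ : Integrable (fun x => ‖x‖ ^ 2) μ) (hμK : ∫ x, ‖x‖ ^ 2 ∂μ ≤ K) (hK : 1 ≤ K)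
    (hp : 1 ≤ p) (hrB : 1 ≤ r * B) (hB : 0 ≤ B) (hL : 1 ≤ L) (hθ : θ ∈ cube p L r B)
    (hθ' : θ' ∈ cube p L r B) :
    sqDist μ f (clipped C θ) ≤ 2 * sqDist μ f (clipped C θ')
      + 32 * p * K * ((2 * r * B) ^ L * ‖θ - θ'‖) ^ 2 := by
  have hint : ∀ θ : Param p L r, Integrable (fun x => (clipped C θ x - f x) ^ 2) μ := fun θ =>
    integrable_sq_sub hf (measurable_clipped C θ) hfC (ae_of_all _ (abs_clipped_le hC θ))
  have hint_lip : Integrable (fun x : EuclideanSpace ℝ (Fin p) =>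
      8 * ((2 * r * B) ^ L * ‖θ - θ'‖) ^ 2 * (2 + 2 * p * ‖x‖ ^ 2)) μ :=
    ((integrable_const _).add (hμ.const_mul _)).const_mul _
  have hpointwise : ∀ x, (clipped C θ x - f x) ^ 2 ≤ 2 * (clipped C θ' x - f x) ^ 2
      + 8 * ((2 * r * B) ^ L * ‖θ - θ'‖) ^ 2 * (2 + 2 * p * ‖x‖ ^ 2) := fun x => by
    have htriangle := add_sq_le (a := clipped C θ x - clipped C θ' x) (b := clipped C θ' x - f x)
    rw [sub_add_sub_cancel] at htriangle
    linarith [sq_clipped_sub_le hrB hB hL hθ hθ' C x]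
  calc sqDist μ f (clipped C θ)
      ≤ ∫ x, (2 * (clipped C θ' x - f x) ^ 2
        + 8 * ((2 * r * B) ^ L * ‖θ - θ'‖) ^ 2 * (2 + 2 * p * ‖x‖ ^ 2)) ∂μ :=
        integral_mono (hint θ) (((hint θ').const_mul 2).add hint_lip) hpointwise
    _ = 2 * sqDist μ f (clipped C θ')
        + 8 * ((2 * r * B) ^ L * ‖θ - θ'‖) ^ 2 * (2 + 2 * p * ∫ x, ‖x‖ ^ 2 ∂μ) := by
        rw [integral_add ((hint θ').const_mul 2) hint_lip, integral_const_mul, integral_const_mul,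
          integral_add (integrable_const _) (hμ.const_mul _), integral_const_mul]
        simp [sqDist]
    _ ≤ 2 * sqDist μ f (clipped C θ')
        + 8 * ((2 * r * B) ^ L * ‖θ - θ'‖) ^ 2 * (4 * (p * K)) := by
        have hpK : 1 ≤ p * K := one_le_mul_of_one_le_of_one_le (mod_cast hp) hK
        have : (p : ℝ) * ∫ x, ‖x‖ ^ 2 ∂μ ≤ p * K := by gcongr
        gcongr
        linarith
    _ = _ := by ring

end Lipschitz

/-! ### The prior -/

section Prior

variable {B u : ℝ}

theorem measurableSet_cube : MeasurableSet (cube p L r B) := measurableSet_Icc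

theorem volume_cube (hB : 0 ≤ B) :
    volume (cube p L r B) = ENNReal.ofReal ((2 * B) ^ numParams p L r) := by
  rw [cube, Real.volume_Icc_pi, ← card_paramIndex, ENNReal.ofReal_pow (by positivity)]
  simp [two_mul]

theorem isProbabilityMeasure_prior (hB : 0 < B) : IsProbabilityMeasure (prior p L r B) :=
  cond_isProbabilityMeasure_of_finite
    (by simpa only [volume_cube hB.le, ne_eq, ENNReal.ofReal_eq_zero, not_le] using by positivity)
    (by simp only [volume_cube hB.le, ne_eq, ENNReal.ofReal_ne_top, not_false_eq_true])

theorem prior_apply (hB : 0 < B) (S : Set (Param p L r)) :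
    prior p L r B S = volume (cube p L r B ∩ S) / ENNReal.ofReal ((2 * B) ^ numParams p L r) := by
  rw [prior, cond_apply measurableSet_cube, volume_cube hB.le, ENNReal.div_eq_inv_mul]

theorem prior_closedBall_zero_le (hB : 0 < B) (hu : 0 ≤ u) :
    prior p L r B {θ | ‖θ‖ ≤ u} ≤ ENNReal.ofReal ((u / B) ^ numParams p L r) := by
  have hsubset : cube p L r B ∩ {θ | ‖θ‖ ≤ u} ⊆ cube p L r u := fun θ hθ =>
    ⟨fun i => (abs_le.1 ((norm_le_pi_norm θ i).trans hθ.2)).1,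
      fun i => (abs_le.1 ((norm_le_pi_norm θ i).trans hθ.2)).2⟩
  rw [prior_apply hB]
  refine (ENNReal.div_le_div_right (measure_mono hsubset) _).trans_eq ?_
  rw [volume_cube hu, ← ENNReal.ofReal_div_of_pos (by positivity), ← div_pow,
    mul_div_mul_left _ _ two_ne_zero]

theorem le_min_add_sub_max_sub {B u t : ℝ} (hu : 0 ≤ u) (huB : u ≤ 2 * B) (htB : -B ≤ t)
    (ht : t ≤ B) : u ≤ min B (t + u) - max (-B) (t - u) := by
  rcases max_cases (-B) (t - u) with hmax | hmax <;>
    rcases min_cases B (t + u) with hmin | hmin <;> linarith [hmax.1, hmin.1]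

theorem le_prior_closedBall (hB : 0 < B) (hu : 0 ≤ u) (huB : u ≤ 2 * B) {θs : Param p L r}
    (hθs : θs ∈ cube p L r B) :
    ENNReal.ofReal ((u / (2 * B)) ^ numParams p L r) ≤
      prior p L r B {θ | θ ∈ cube p L r B ∧ ‖θ - θs‖ ≤ u} := by
  have hsubset : Set.Icc (fun i => max (-B) (θs i - u)) (fun i => min B (θs i + u)) ⊆
      cube p L r B ∩ {θ | θ ∈ cube p L r B ∧ ‖θ - θs‖ ≤ u} := by
    intro θ hθ
    have hcube : θ ∈ cube p L r B := ⟨fun i => (le_max_left _ _).trans (hθ.1 i),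
      fun i => (hθ.2 i).trans (min_le_left _ _)⟩
    refine ⟨hcube, hcube, (pi_norm_le_iff_of_nonneg hu).2 fun i => ?_⟩
    have hlower := (le_max_right _ _).trans (hθ.1 i)
    have hupper := (hθ.2 i).trans (min_le_right _ _)
    rw [Pi.sub_apply, Real.norm_eq_abs, abs_le]
    constructor <;> linarith
  rw [prior_apply hB, div_pow, ENNReal.ofReal_div_of_pos (by positivity)]
  gcongr
  refine le_trans ?_ (measure_mono hsubset)
  rw [Real.volume_Icc_pi, ← card_paramIndex, ENNReal.ofReal_pow hu, ← Finset.card_univ,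
    ← Finset.prod_const]
  exact Finset.prod_le_prod' fun i _ => ENNReal.ofReal_le_ofReal
    (le_min_add_sub_max_sub hu huB (hθs.1 i) (hθs.2 i))

end Prior

theorem numParams_le (hp : 1 ≤ p) (hL : 1 ≤ L) (hr : 1 ≤ r) :
    numParams p L r ≤ 4 * p * L * r ^ 2 := by
  obtain ⟨p, rfl⟩ : ∃ k, p = k + 1 := ⟨p - 1, by omega⟩
  obtain ⟨L, rfl⟩ : ∃ k, L = k + 1 := ⟨L - 1, by omega⟩
  obtain ⟨r, rfl⟩ : ∃ k, r = k + 1 := ⟨r - 1, by omega⟩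
  simp only [numParams, Nat.add_sub_cancel]
  nlinarith [Nat.zero_le (p * L * r ^ 2), Nat.zero_le (p * L * r), Nat.zero_le (p * r ^ 2),
    Nat.zero_le (L * r ^ 2), Nat.zero_le (p * L), Nat.zero_le (p * r), Nat.zero_le (L * r),
    Nat.zero_le (r ^ 2)]

theorem one_le_numParams : 1 ≤ numParams p L r := by
  unfold numParams
  omega

end Network

/-! ### Exponential moments and exceptional events -/

section ExpMoment

variable {T : Type*} [MeasurableSpace T] {π : Measure T} {s : T → ℝ} {t b : ℝ}

/-- The exponential moment of `s` at `t` is at most the one of the constant `b`: at the level of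
exponential moments, `s` does not exceed `b`. -/
def HasExpMomentLE (π : Measure T) (s : T → ℝ) (t b : ℝ) : Prop :=
  ∫⁻ θ, ENNReal.ofReal (Real.exp (t * s θ)) ∂π ≤ ENNReal.ofReal (Real.exp (t * b))

theorem HasExpMomentLE.measure_compl_le (h : HasExpMomentLE π s t b) (hs : AEMeasurable s π)
    (ht : 0 < t) {η : ℝ} (hη : 0 < η) :
    π {θ | s θ ≤ b + Real.log (1 / η) / t}ᶜ ≤ ENNReal.ofReal η := by
  refine (measure_mono fun θ hθ => ?_).trans
    (measure_ofReal_div_le_le (by fun_prop) (Real.exp_pos _) hη h)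
  simp only [Set.mem_compl_iff, Set.mem_ofPred_eq, not_le] at hθ ⊢
  refine ENNReal.ofReal_le_ofReal ?_
  calc Real.exp (t * b) / η = Real.exp (t * (b + Real.log (1 / η) / t)) := by
        rw [mul_add, mul_div_cancel₀ _ ht.ne', Real.exp_add, Real.exp_log (by positivity)]
        ring
    _ ≤ Real.exp (t * s θ) := by gcongr

theorem HasExpMomentLE.integral_le [IsProbabilityMeasure π] (h : HasExpMomentLE π s t b)
    (hs : Integrable s π) (ht : 0 < t) : ∫ θ, s θ ∂π ≤ b := by
  have hexp : Integrable (fun θ => Real.exp (t * s θ)) π := by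
    refine ⟨(Real.continuous_exp.comp_aestronglyMeasurable (hs.const_mul t).1), ?_⟩
    rw [hasFiniteIntegral_iff_ofReal (ae_of_all _ fun θ => (Real.exp_pos _).le)]
    exact h.trans_lt ENNReal.ofReal_lt_top
  have hjensen : Real.exp (∫ θ, t * s θ ∂π) ≤ ∫ θ, Real.exp (t * s θ) ∂π :=
    convexOn_exp.map_integral_le Real.continuous_exp.continuousOn isClosed_univ
      (ae_of_all _ fun _ => Set.mem_univ _) (hs.const_mul t) hexp
  unfold HasExpMomentLE at h
  rw [← ofReal_integral_eq_lintegral_ofReal hexp (ae_of_all _ fun θ => (Real.exp_pos _).le),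
    ENNReal.ofReal_le_ofReal_iff (Real.exp_pos _).le] at h
  have := Real.exp_le_exp.1 (hjensen.trans h)
  rw [integral_const_mul] at this
  exact le_of_mul_le_mul_left this ht

variable [IsProbabilityMeasure π]

theorem ofReal_one_sub_le_of_compl {S : Set T} {η : ℝ} (hη : 0 ≤ η)
    (h : π Sᶜ ≤ ENNReal.ofReal η) : ENNReal.ofReal (1 - η) ≤ π S := by
  rw [ENNReal.ofReal_sub _ hη, ENNReal.ofReal_one, tsub_le_iff_right, ← measure_univ (μ := π),
    ← Set.union_compl_self S]
  exact (measure_union_le _ _).trans (by gcongr)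

theorem ofReal_one_sub_add_le_lintegral {F : T → ℝ≥0∞} {δ η : ℝ} (hδ : 0 ≤ δ) (hη : 0 ≤ η)
    (hη1 : η ≤ 1) (h : π {ω | ¬ ENNReal.ofReal (1 - η) ≤ F ω} ≤ ENNReal.ofReal δ) :
    ENNReal.ofReal (1 - (δ + η)) ≤ ∫⁻ ω, F ω ∂π := by
  set N := toMeasurable π {ω | ¬ ENNReal.ofReal (1 - η) ≤ F ω}
  have hN : MeasurableSet N := measurableSet_toMeasurable _ _
  have hcompl : ENNReal.ofReal (1 - δ) ≤ π Nᶜ :=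
    ofReal_one_sub_le_of_compl hδ (by rwa [compl_compl, measure_toMeasurable])
  calc ENNReal.ofReal (1 - (δ + η)) ≤ ENNReal.ofReal ((1 - η) * (1 - δ)) :=
        ENNReal.ofReal_le_ofReal (by linarith [mul_nonneg hη hδ])
    _ ≤ ENNReal.ofReal (1 - η) * π Nᶜ := by
        rw [ENNReal.ofReal_mul (sub_nonneg.2 hη1)]
        gcongr
    _ = ∫⁻ _ in Nᶜ, ENNReal.ofReal (1 - η) ∂π := (setLIntegral_const _ _).symm
    _ ≤ ∫⁻ ω in Nᶜ, F ω ∂π := setLIntegral_mono' hN.compl fun ω hω => by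
        by_contra hF
        exact hω (subset_toMeasurable _ _ hF)
    _ ≤ ∫⁻ ω, F ω ∂π := setLIntegral_le_lintegral _ _

end ExpMoment

/-! ### Squared distances and credible balls -/

section SqDist

variable {E T : Type*} [MeasurableSpace E] [MeasurableSpace T] {μ : Measure E} {f g h : E → ℝ}
  {F : T → E → ℝ} {C : ℝ}

theorem sqDist_comm (μ : Measure E) (f h : E → ℝ) : sqDist μ f h = sqDist μ h f :=
  integral_congr_ae (ae_of_all _ fun x => by ring)

theorem sqDist_le_two_mul (hf : MemLp f 2 μ) (hg : MemLp g 2 μ) (hh : MemLp h 2 μ) :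
    sqDist μ g h ≤ 2 * sqDist μ f h + 2 * sqDist μ f g := by
  have hhf : Integrable (fun x => (h x - f x) ^ 2) μ := (hh.sub hf).integrable_sq
  have hgf : Integrable (fun x => (g x - f x) ^ 2) μ := (hg.sub hf).integrable_sq
  unfold sqDist
  rw [← integral_const_mul, ← integral_const_mul,
    ← integral_add (hhf.const_mul 2) (hgf.const_mul 2)]
  refine integral_mono (hh.sub hg).integrable_sq ((hhf.const_mul 2).add (hgf.const_mul 2))
    fun x => ?_
  have := add_sq_le (a := h x - f x) (b := f x - g x)
  rw [sub_add_sub_cancel] at this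
  simp only
  linarith [sub_sq_comm (f x) (g x)]

theorem measurable_sqDist [SFinite μ] (hf : Measurable f)
    (hF : Measurable (Function.uncurry F)) : Measurable fun θ => sqDist μ f (F θ) := by
  have hsq : Measurable fun z : T × E => (F z.1 z.2 - f z.2) ^ 2 :=
    (hF.sub (hf.comp measurable_snd)).pow_const 2
  exact hsq.stronglyMeasurable.integral_prod_right'.measurable

theorem sqDist_le [IsProbabilityMeasure μ] (hf : Measurable f) (hh : Measurable h)
    (hfC : ∀ᵐ x ∂μ, |f x| ≤ C) (hhC : ∀ᵐ x ∂μ, |h x| ≤ C) : sqDist μ f h ≤ (2 * C) ^ 2 := by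
  calc sqDist μ f h ≤ ∫ _, (2 * C) ^ 2 ∂μ := by
        refine integral_mono_ae (integrable_sq_sub hf hh hfC hhC) (integrable_const _) ?_
        filter_upwards [hfC, hhC] with x hfx hhx
        exact sq_le_sq.2 ((abs_sub_le_two_mul hhx hfx).trans (le_abs_self _))
    _ = _ := by simp

theorem sq_integral_sub_le {π : Measure T} [IsProbabilityMeasure π] {v : T → ℝ}
    (hv : MemLp v 2 π) (c : ℝ) : (∫ θ, v θ ∂π - c) ^ 2 ≤ ∫ θ, (v θ - c) ^ 2 ∂π := by
  have hint : Integrable v π := hv.integrable one_le_two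
  have hjensen := (even_two.convexOn_pow (𝕜 := ℝ)).map_integral_le
    (continuous_pow 2).continuousOn isClosed_univ (ae_of_all _ fun θ => Set.mem_univ _)
    (hint.sub (integrable_const c)) (hv.sub (memLp_const c)).integrable_sq
  simpa only [Pi.sub_apply, integral_sub hint (integrable_const c), integral_const,
    probReal_univ, one_smul] using hjensen

theorem sqDist_integral_le {π : Measure T} [IsProbabilityMeasure π] [IsProbabilityMeasure μ]
    (hf : Measurable f) (hfC : ∀ᵐ x ∂μ, |f x| ≤ C) (hF : Measurable (Function.uncurry F))
    (hFC : ∀ θ x, |F θ x| ≤ C) :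
    sqDist μ f (fun x => ∫ θ, F θ x ∂π) ≤ ∫ θ, sqDist μ f (F θ) ∂π := by
  have hjoint : Measurable fun z : T × E => (F z.1 z.2 - f z.2) ^ 2 :=
    (hF.sub (hf.comp measurable_snd)).pow_const 2
  have hint : Integrable (fun z : T × E => (F z.1 z.2 - f z.2) ^ 2) (π.prod μ) := by
    refine Integrable.of_bound hjoint.aestronglyMeasurable ((2 * C) ^ 2) ?_
    filter_upwards [(Measure.quasiMeasurePreserving_snd (μ := π) (ν := μ)).ae hfC] with z hz
    rw [Real.norm_of_nonneg (sq_nonneg _)]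
    exact sq_le_sq.2 ((abs_sub_le_two_mul (hFC z.1 z.2) hz).trans (le_abs_self _))
  have hFx : ∀ x, MemLp (fun θ => F θ x) 2 π := fun x =>
    MemLp.of_bound (hF.comp measurable_prodMk_right).aestronglyMeasurable C
      (ae_of_all _ fun θ => hFC θ x)
  calc sqDist μ f (fun x => ∫ θ, F θ x ∂π) ≤ ∫ x, ∫ θ, (F θ x - f x) ^ 2 ∂π ∂μ :=
        integral_mono_of_nonneg (ae_of_all _ fun x => sq_nonneg _) hint.integral_prod_right
          (ae_of_all _ fun x => sq_integral_sub_le (hFx x) (f x))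
    _ = _ := (integral_integral_swap hint).symm

end SqDist

section L2Norm

variable {p : ℕ} {μ : Measure (EuclideanSpace ℝ (Fin p))} {f h : EuclideanSpace ℝ (Fin p) → ℝ}

theorem l2Norm_nonneg (h : EuclideanSpace ℝ (Fin p) → ℝ) : 0 ≤ l2Norm μ h :=
  ENNReal.toReal_nonneg

theorem sq_l2Norm_sub (hf : MemLp f 2 μ) (hh : MemLp h 2 μ) :
    l2Norm μ (fun x => h x - f x) ^ 2 = sqDist μ f h := by
  have hhf : MemLp (fun x => h x - f x) 2 μ := hh.sub hf
  unfold l2Norm sqDist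
  rw [hhf.eLpNorm_eq_integral_rpow_norm (by simp) (by simp),
    ENNReal.toReal_ofReal (by positivity), ← Real.rpow_natCast, ← Real.rpow_mul (by positivity)]
  simp

theorem l2Norm_sub_le_iff (hf : MemLp f 2 μ) (hh : MemLp h 2 μ) {τ : ℝ} (hτ : 0 ≤ τ) :
    l2Norm μ (fun x => h x - f x) ≤ τ ↔ sqDist μ f h ≤ τ ^ 2 := by
  rw [← sq_l2Norm_sub hf hh, sq_le_sq₀ (l2Norm_nonneg _) hτ]

theorem l2Diam_l2Ball_le (hf : MemLp f 2 μ) {τ : ℝ} :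
    l2Diam μ (l2Ball μ f τ) ≤ ENNReal.ofReal (2 * τ) := by
  have hradius : ∀ g ∈ l2Ball μ f τ, eLpNorm (fun x => g x - f x) 2 μ ≤ ENNReal.ofReal τ := by
    rintro g ⟨hg, hgτ⟩
    have hgf : MemLp (fun x => g x - f x) 2 μ := hg.sub hf
    rw [← ENNReal.ofReal_toReal hgf.eLpNorm_ne_top]
    exact ENNReal.ofReal_le_ofReal hgτ
  refine iSup₂_le fun g hg => iSup₂_le fun h hh => ?_
  have hτ : 0 ≤ τ := (l2Norm_nonneg _).trans hg.2
  calc eLpNorm (fun x => g x - h x) 2 μ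
      = eLpNorm ((fun x => g x - f x) - fun x => h x - f x) 2 μ := by
        congr 1
        ext x
        simp
    _ ≤ eLpNorm (fun x => g x - f x) 2 μ + eLpNorm (fun x => h x - f x) 2 μ :=
        eLpNorm_sub_le (hg.1.sub hf).1 (hh.1.sub hf).1 one_le_two
    _ ≤ ENNReal.ofReal τ + ENNReal.ofReal τ := add_le_add (hradius g hg) (hradius h hh)
    _ = _ := by rw [← ENNReal.ofReal_add hτ hτ, two_mul]

end L2Norm

/-! ### The surrogate posterior -/

section SurrogatePosterior

variable {p L r n : ℕ} {C B Ξ ρ : ℝ}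

theorem surrogatePosterior_eq_likelihoodPosterior (hn : n ≠ 0) (hΞ : Ξ ≠ 0)
    (d : Fin n → EuclideanSpace ℝ (Fin p) × ℝ) :
    surrogatePosterior L r C B (n / Ξ) ρ d = likelihoodPosterior (prior p L r B)
      (fun θ z => residualWeight Ξ (1 - ρ) (z.2 - clipped C θ z.1)) d := by
  have hn' : (n : ℝ) ≠ 0 := by exact_mod_cast hn
  unfold surrogatePosterior likelihoodPosterior
  congr 1
  ext θ
  have hcancel : -((n : ℝ) / Ξ) * -(1 / (n / Ξ)) = 1 := by field_simp
  rw [surrogateRisk, ← mul_assoc, hcancel, one_mul]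
  refine Finset.sum_congr rfl fun i _ => ?_
  have hscale : -((n : ℝ) / Ξ / n) * loss C (d i) θ
      = -(((d i).2 - clipped C θ (d i).1) ^ 2 / Ξ) := by
    unfold loss
    field_simp
  simp only [residualWeight, hscale, add_sub_assoc]

theorem measurable_uncurry_residualWeight_clipped (C Ξ a : ℝ) :
    Measurable (Function.uncurry fun (θ : Param p L r) (z : EuclideanSpace ℝ (Fin p) × ℝ) =>
      residualWeight Ξ a (z.2 - clipped C θ z.1)) := by
  have hclipped : Measurable fun x : Param p L r × (EuclideanSpace ℝ (Fin p) × ℝ) =>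
      clipped C x.1 x.2.1 :=
    (measurable_uncurry_clipped C).comp
      (measurable_fst.prodMk (measurable_fst.comp measurable_snd))
  exact (measurable_residualWeight Ξ a).comp
    ((measurable_snd.comp measurable_snd).sub hclipped)

theorem integrable_likelihood_residualWeight_clipped (hΞ : 0 ≤ Ξ) (hρ : ρ ≤ 1) (hB : 0 < B)
    (d : Fin n → EuclideanSpace ℝ (Fin p) × ℝ) :
    Integrable (likelihood (fun (θ : Param p L r) z =>
      residualWeight Ξ (1 - ρ) (z.2 - clipped C θ z.1)) d) (prior p L r B) := by
  have := isProbabilityMeasure_prior (p := p) (L := L) (r := r) hB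
  exact integrable_likelihood (measurable_uncurry_residualWeight_clipped C Ξ (1 - ρ))
    (fun θ z => residualWeight_pos (sub_nonneg.2 hρ) _) (fun θ z => residualWeight_le hΞ _ _) d

/-- The weight of `f_θ` at a data point relative to the one of the regression function `f`, that is,
the likelihood ratio of the pseudo-model with density `residualWeight Ξ (1 - ρ)`. The denominator
does not depend on `θ` and hence cancels in the posterior. -/
noncomputable def weightRatio (C Ξ ρ : ℝ) (f : EuclideanSpace ℝ (Fin p) → ℝ) (θ : Param p L r)
    (z : EuclideanSpace ℝ (Fin p) × ℝ) : ℝ :=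
  residualWeight Ξ (1 - ρ) (z.2 - clipped C θ z.1) / residualWeight Ξ (1 - ρ) (z.2 - f z.1)

variable {f : EuclideanSpace ℝ (Fin p) → ℝ}

theorem weightRatio_pos (hρ : ρ ≤ 1) (θ : Param p L r) (z : EuclideanSpace ℝ (Fin p) × ℝ) :
    0 < weightRatio C Ξ ρ f θ z :=
  div_pos (residualWeight_pos (sub_nonneg.2 hρ) _) (residualWeight_pos (sub_nonneg.2 hρ) _)

theorem measurable_uncurry_weightRatio (hf : Measurable f) :
    Measurable (Function.uncurry (weightRatio (L := L) (r := r) C Ξ ρ f)) :=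
  (measurable_uncurry_residualWeight_clipped C Ξ (1 - ρ)).div
    ((measurable_residualWeight Ξ (1 - ρ)).comp (by fun_prop))

theorem integrable_likelihood_weightRatio (hΞ : 0 ≤ Ξ) (hρ : ρ ≤ 1) (hB : 0 < B)
    (d : Fin n → EuclideanSpace ℝ (Fin p) × ℝ) :
    Integrable (likelihood (weightRatio (L := L) (r := r) C Ξ ρ f) d) (prior p L r B) := by
  unfold likelihood weightRatio
  simp only [Finset.prod_div_distrib]
  exact (integrable_likelihood_residualWeight_clipped hΞ hρ hB d).div_const _

theorem likelihoodPosterior_weightRatio (hn : n ≠ 0) (hΞ : Ξ ≠ 0) (hρ : ρ ≤ 1)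
    (d : Fin n → EuclideanSpace ℝ (Fin p) × ℝ) :
    likelihoodPosterior (prior p L r B) (weightRatio C Ξ ρ f) d
      = surrogatePosterior L r C B (n / Ξ) ρ d := by
  rw [surrogatePosterior_eq_likelihoodPosterior hn hΞ]
  exact likelihoodPosterior_div (fun θ z => residualWeight_pos (sub_nonneg.2 hρ) _)
    (fun z => residualWeight_pos (sub_nonneg.2 hρ) _) d

theorem isProbabilityMeasure_surrogatePosterior (hn : n ≠ 0) (hΞ : 0 < Ξ) (hρ : ρ ≤ 1)
    (hB : 0 < B) (d : Fin n → EuclideanSpace ℝ (Fin p) × ℝ) :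
    IsProbabilityMeasure (surrogatePosterior L r C B (n / Ξ) ρ d) := by
  have := isProbabilityMeasure_prior (p := p) (L := L) (r := r) hB
  rw [surrogatePosterior_eq_likelihoodPosterior hn hΞ.ne']
  exact isProbabilityMeasure_likelihoodPosterior
    (fun θ z => residualWeight_pos (sub_nonneg.2 hρ) _)
    (integrable_likelihood_residualWeight_clipped hΞ.le hρ hB d)

theorem surrogatePosterior_real_closedBall {lam : ℝ} (hB : 0 ≤ B)
    (d : Fin n → EuclideanSpace ℝ (Fin p) × ℝ)
    [IsProbabilityMeasure (surrogatePosterior L r C B lam ρ d)] :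
    (surrogatePosterior L r C B lam ρ d).real {θ | ‖θ‖ ≤ B} = 1 := by
  have hcube : ∀ᵐ θ ∂(prior p L r B), ‖θ‖ ≤ B := by
    filter_upwards [ae_cond_mem (μ := volume) (measurableSet_cube (p := p) (L := L) (r := r))]
      with θ hθ
    exact (pi_norm_le_iff_of_nonneg hB).2 fun i => abs_le_of_mem_cube hθ i
  have hposterior : ∀ᵐ θ ∂(surrogatePosterior L r C B lam ρ d), ‖θ‖ ≤ B :=
    (tilted_absolutelyContinuous _ _).ae_le hcube
  rw [measureReal_def, (mem_ae_iff_prob_eq_one (measurableSet_le measurable_norm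
    measurable_const)).1 hposterior, ENNReal.toReal_one]

theorem measurable_posteriorMean {lam : ℝ} (d : Fin n → EuclideanSpace ℝ (Fin p) × ℝ)
    [IsProbabilityMeasure (surrogatePosterior L r C B lam ρ d)] :
    Measurable (posteriorMean L r C B lam ρ d) :=
  (measurable_uncurry_clipped C).stronglyMeasurable.integral_prod_left.measurable

theorem abs_posteriorMean_le {lam : ℝ} (hC : 0 ≤ C) (d : Fin n → EuclideanSpace ℝ (Fin p) × ℝ)
    [IsProbabilityMeasure (surrogatePosterior L r C B lam ρ d)] (x : EuclideanSpace ℝ (Fin p)) :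
    |posteriorMean L r C B lam ρ d x| ≤ C := by
  have hbound := norm_integral_le_of_norm_le_const (μ := surrogatePosterior L r C B lam ρ d)
    (f := fun θ => clipped C θ x) (ae_of_all _ fun θ => abs_clipped_le hC θ x)
  rwa [probReal_univ, mul_one, Real.norm_eq_abs] at hbound

end SurrogatePosterior

/-! ### The experiment -/

section Experiment

variable {p L r n : ℕ} {Ω : Type*} [MeasurableSpace Ω] {P : Measure Ω} [IsProbabilityMeasure P]
  {X : Ω → EuclideanSpace ℝ (Fin p)} {Y : Ω → ℝ} {f : EuclideanSpace ℝ (Fin p) → ℝ}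
  {C K σ Γ Ξ B ρ : ℝ} {D : Fin n → Ω → EuclideanSpace ℝ (Fin p) × ℝ} {θs : Param p L r}

namespace IsSample

omit [IsProbabilityMeasure P] in
theorem aemeasurable (hD : IsSample P X Y D) : AEMeasurable (fun ω i => D i ω) P :=
  aemeasurable_pi_lambda _ fun i => (hD.identDistrib i).aemeasurable_fst

theorem map_eq (hD : IsSample P X Y D) :
    P.map (fun ω i => D i ω) = Measure.pi fun _ => P.map fun ω => (X ω, Y ω) := by
  rw [(iIndepFun_iff_map_fun_eq_pi_map fun i => (hD.identDistrib i).aemeasurable_fst).1 hD.indep]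
  simp_rw [fun i => (hD.identDistrib i).map_eq]

theorem measure_mem_le (hD : IsSample P X Y D) {s : Set (Fin n → EuclideanSpace ℝ (Fin p) × ℝ)}
    {c : ℝ≥0∞} (hs : (Measure.pi fun _ => P.map fun ω => (X ω, Y ω)) s ≤ c) :
    P {ω | (fun i => D i ω) ∈ s} ≤ c :=
  (Measure.le_map_apply hD.aemeasurable s).trans (hD.map_eq ▸ hs)

end IsSample

/-- The regression experiment: a sample of size `n` from the regression model, an admissible inverse
temperature `n / Ξ` and a large-sample regime. The parameter `θs` of the cube is the reference
against which the posterior is compared; for the oracle it is a minimizer of the risk. -/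
structure IsExperiment (P : Measure Ω) [IsProbabilityMeasure P]
    (X : Ω → EuclideanSpace ℝ (Fin p)) (Y : Ω → ℝ) (f : EuclideanSpace ℝ (Fin p) → ℝ)
    (C K σ Γ Ξ B ρ : ℝ) (D : Fin n → Ω → EuclideanSpace ℝ (Fin p) × ℝ) (θs : Param p L r) :
    Prop where
  model : IsBoundedRegression P X Y f C K σ Γ
  sample : IsSample P X Y D
  temperature : IsTemperature C σ Γ Ξ
  large : IsLargeSample n p L r B K
  one_le_K : 1 ≤ K
  one_le_B : 1 ≤ B
  one_le_p : 1 ≤ p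
  one_le_L : 1 ≤ L
  one_le_r : 1 ≤ r
  ρ_nonneg : 0 ≤ ρ
  ρ_le_one : ρ ≤ 1
  mem_cube : θs ∈ cube p L r B

namespace IsExperiment

variable (E : IsExperiment P X Y f C K σ Γ Ξ B ρ D θs)

include E

theorem C_nonneg : 0 ≤ C := E.temperature.C_pos.le

theorem Ξ_pos : 0 < Ξ := E.temperature.pos

theorem B_pos : 0 < B := one_pos.trans_le E.one_le_B

theorem n_ne_zero : n ≠ 0 := (two_pos.trans_le E.large.1).ne'

theorem one_le_mul : 1 ≤ r * B :=
  one_le_mul_of_one_le_of_one_le (by exact_mod_cast E.one_le_r) E.one_le_B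

theorem isProbabilityMeasure_posterior (d : Fin n → EuclideanSpace ℝ (Fin p) × ℝ) :
    IsProbabilityMeasure (surrogatePosterior L r C B (n / Ξ) ρ d) :=
  isProbabilityMeasure_surrogatePosterior E.n_ne_zero E.Ξ_pos E.ρ_le_one E.B_pos d

theorem sqDist_clipped_le_of_norm_sub_le {θ : Param p L r} (hθ : θ ∈ cube p L r B) {u : ℝ}
    (hu : ‖θ - θs‖ ≤ u) :
    sqDist (P.map X) f (clipped C θ)
      ≤ 2 * sqDist (P.map X) f (clipped C θs) + 32 * p * K * ((2 * r * B) ^ L * u) ^ 2 := by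
  have := E.model.isProbabilityMeasure_map
  have hX : AEMeasurable X P := E.model.measurable_X.aemeasurable
  have hsq : AEStronglyMeasurable (fun x : EuclideanSpace ℝ (Fin p) => ‖x‖ ^ 2) (P.map X) := by
    fun_prop
  have hμ : Integrable (fun x => ‖x‖ ^ 2) (P.map X) :=
    (integrable_map_measure hsq hX).2 E.model.integrable_input
  have hμK : ∫ x, ‖x‖ ^ 2 ∂(P.map X) ≤ K := (integral_map hX hsq).trans_le E.model.second_moment
  have hB := E.B_pos
  have hK := E.one_le_K
  refine (sqDist_clipped_le E.model.measurable_f E.model.bounded E.C_nonneg hμ hμK hK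
    E.one_le_p E.one_le_mul hB.le E.one_le_L hθ E.mem_cube).trans ?_
  gcongr

theorem lintegral_weightRatio_le (θ : Param p L r) :
    ∫⁻ z, ENNReal.ofReal (weightRatio C Ξ ρ f θ z) ∂(P.map fun ω => (X ω, Y ω))
      ≤ ENNReal.ofReal (Real.exp (-(sqDist (P.map X) f (clipped C θ) / (4 * Ξ)))) :=
  E.model.lintegral_residualWeight_div_le E.temperature (sub_nonneg.2 E.ρ_le_one)
    (sub_le_self 1 E.ρ_nonneg) (measurable_clipped C θ) (ae_of_all _ (abs_clipped_le E.C_nonneg θ))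

theorem lintegral_weightRatio_inv_le (θ : Param p L r) :
    ∫⁻ z, ENNReal.ofReal (weightRatio C Ξ ρ f θ z)⁻¹ ∂(P.map fun ω => (X ω, Y ω))
      ≤ ENNReal.ofReal (Real.exp (3 * sqDist (P.map X) f (clipped C θ) / (2 * Ξ))) := by
  simp only [weightRatio, inv_div]
  exact E.model.lintegral_residualWeight_div_inv_le E.temperature (sub_nonneg.2 E.ρ_le_one)
    (measurable_clipped C θ) (ae_of_all _ (abs_clipped_le E.C_nonneg θ))

theorem setLIntegral_lintegral_weightRatio_inv_le (u : ℝ) :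
    ∫⁻ θ in {θ | θ ∈ cube p L r B ∧ ‖θ - θs‖ ≤ u},
      (∫⁻ z, ENNReal.ofReal (weightRatio C Ξ ρ f θ z)⁻¹ ∂(P.map fun ω => (X ω, Y ω))) ^ n
        ∂(prior p L r B)
      ≤ ENNReal.ofReal (Real.exp (3 * (2 * sqDist (P.map X) f (clipped C θs)
          + 32 * p * K * ((2 * r * B) ^ L * u) ^ 2) / (2 * Ξ)) ^ n
        * (prior p L r B).real {θ | θ ∈ cube p L r B ∧ ‖θ - θs‖ ≤ u}) := by
  have hΞ := E.Ξ_pos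
  have := isProbabilityMeasure_prior (p := p) (L := L) (r := r) E.B_pos
  have hball : MeasurableSet {θ : Param p L r | θ ∈ cube p L r B ∧ ‖θ - θs‖ ≤ u} :=
    measurableSet_cube.inter (measurableSet_le (measurable_id.sub_const θs).norm measurable_const)
  rw [ENNReal.ofReal_mul (by positivity), ENNReal.ofReal_pow (by positivity), ofReal_measureReal,
    ← setLIntegral_const]
  refine setLIntegral_mono' hball fun θ hθ => ?_
  gcongr
  refine (E.lintegral_weightRatio_inv_le θ).trans ?_
  gcongr
  exact E.sqDist_clipped_le_of_norm_sub_le hθ.1 hθ.2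

theorem measure_not_lintegral_posterior_le_le {u : ℝ} (hu : 0 < u) (huB : u ≤ 2 * B)
    {k : Param p L r → ℝ≥0∞} (hk : Measurable k) {J : ℝ} (hJ : 0 < J)
    (hkJ : ∫⁻ θ, k θ * ENNReal.ofReal (Real.exp (-(sqDist (P.map X) f (clipped C θ) / (4 * Ξ)))) ^ n
      ∂(prior p L r B) ≤ ENNReal.ofReal J) {δ : ℝ} (hδ : 0 < δ) :
    P {ω | ¬ ∫⁻ θ, k θ ∂(surrogatePosterior L r C B (n / Ξ) ρ fun i => D i ω)
      ≤ ENNReal.ofReal ((2 / δ) ^ 2 * (Real.exp (3 * (2 * sqDist (P.map X) f (clipped C θs)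
        + 32 * p * K * ((2 * r * B) ^ L * u) ^ 2) / (2 * Ξ)) ^ n * J
          / (u / (2 * B)) ^ numParams p L r))} ≤ ENNReal.ofReal δ := by
  have hB := E.B_pos
  have := isProbabilityMeasure_prior (p := p) (L := L) (r := r) hB
  have : IsProbabilityMeasure (P.map fun ω => (X ω, Y ω)) :=
    Measure.isProbabilityMeasure_map (E.model.measurable_X.prodMk E.model.measurable_Y).aemeasurable
  set S := {θ : Param p L r | θ ∈ cube p L r B ∧ ‖θ - θs‖ ≤ u}
  have hmass : (u / (2 * B)) ^ numParams p L r ≤ (prior p L r B).real S :=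
    (ENNReal.ofReal_le_iff_le_toReal (measure_ne_top _ _)).1
      (le_prior_closedBall hB hu.le huB E.mem_cube)
  have hmass_pos : 0 < (prior p L r B).real S := lt_of_lt_of_le (by positivity) hmass
  have hnumerator : ∫⁻ θ, k θ * (∫⁻ z, ENNReal.ofReal (weightRatio C Ξ ρ f θ z)
      ∂(P.map fun ω => (X ω, Y ω))) ^ Fintype.card (Fin n) ∂(prior p L r B)
        ≤ ENNReal.ofReal J := by
    rw [Fintype.card_fin]
    refine (lintegral_mono fun θ => ?_).trans hkJ
    gcongr
    exact E.lintegral_weightRatio_le θ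
  have hinverse := E.setLIntegral_lintegral_weightRatio_inv_le u
  rw [← Fintype.card_fin n] at hinverse
  have hPACBayes := measure_not_lintegral_likelihoodPosterior_le_le (ι := Fin n) _
    (measurable_uncurry_weightRatio E.model.measurable_f) (weightRatio_pos E.ρ_le_one)
    (integrable_likelihood_weightRatio E.Ξ_pos.le E.ρ_le_one hB) hmass_pos hk
    (mul_pos (pow_pos (Real.exp_pos _) _) hmass_pos) hJ hnumerator hinverse hδ
  refine le_trans (measure_mono ?_) (E.sample.measure_mem_le hPACBayes)
  intro ω hω hle
  rw [likelihoodPosterior_weightRatio E.n_ne_zero E.Ξ_pos.ne' E.ρ_le_one, Fintype.card_fin] at hle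
  refine hω (hle.trans (ENNReal.ofReal_le_ofReal ?_))
  rw [mul_right_comm, mul_div_assoc, pow_two (Measure.real _ _),
    div_mul_cancel_right₀ hmass_pos.ne', ← div_eq_mul_inv]
  gcongr

end IsExperiment

end Experiment

/-! ### The posterior risk bound -/

namespace IsLargeSample

variable {p L r n : ℕ} {B K : ℝ} (hn : IsLargeSample n p L r B K)

include hn

theorem two_le : (2 : ℝ) ≤ n := by exact_mod_cast hn.1

theorem half_le_log : 1 / 2 ≤ Real.log n := by
  have := Real.log_le_log two_pos hn.two_le
  linarith [Real.log_two_gt_d9]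

theorem half_le_numParams_mul (hL : 1 ≤ L) : 1 / 2 ≤ numParams p L r * L * Real.log n := by
  have hLP : (1 : ℝ) ≤ numParams p L r * L := by
    exact_mod_cast Nat.mul_pos (one_le_numParams (p := p) (L := L) (r := r)) hL
  nlinarith [hn.half_le_log]

theorem mul_pow_mul_sq_le_pow (hB : 0 ≤ B) (hL : 1 ≤ L) :
    2 * B * ((2 * r * B) ^ L * (n : ℝ) ^ 2) ≤ (n : ℝ) ^ (7 * L) := by
  have h2 := hn.two_le
  have hrn : (r : ℝ) ≤ n := by exact_mod_cast hn.2.2.2.2.1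
  calc 2 * B * ((2 * r * B) ^ L * (n : ℝ) ^ 2)
      ≤ n * n * ((n * n * n : ℝ) ^ L * (n : ℝ) ^ 2) := by
        gcongr
        exacts [hn.2.1, hn.2.1]
    _ = (n : ℝ) ^ (4 + 3 * L) := by ring
    _ ≤ (n : ℝ) ^ (7 * L) := pow_le_pow_right₀ (by linarith) (by lia)

theorem mul_mul_sq_inv_le (hK : 0 ≤ K) : p * K * ((n : ℝ) ^ 2)⁻¹ ^ 2 ≤ 1 / 2 * (1 / n) := by
  have h2 := hn.two_le
  have hpn : (p : ℝ) ≤ n := by exact_mod_cast hn.2.2.2.2.2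
  calc (p : ℝ) * K * ((n : ℝ) ^ 2)⁻¹ ^ 2 ≤ (n : ℝ) * n * ((n : ℝ) ^ 2)⁻¹ ^ 2 := by
        gcongr
        exact hn.2.2.1
    _ = 1 / (n : ℝ) * (1 / n) := by field_simp
    _ ≤ 1 / 2 * (1 / (n : ℝ)) := by gcongr

end IsLargeSample

/-- The bound of the oracle inequality for the squared distance to the regression function, where
`R` is the squared distance of the reference network and `t` is the deviation allowed in the
exponent, i.e. the logarithm of an inverse probability. -/
noncomputable def riskBound (Ξ : ℝ) (n p L r : ℕ) (R t : ℝ) : ℝ :=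
  12 * R + ((28 * Ξ + 192) * (numParams p L r * L * Real.log n) + 4 * Ξ * t) / n

section RiskBound

variable {p L r n : ℕ} {Ξ Ξ' B K R t δ : ℝ}

theorem riskBound_add (s : ℝ) :
    riskBound Ξ n p L r R (t + s) = riskBound Ξ n p L r R t + s / (n / (4 * Ξ)) := by
  simp only [riskBound, div_div_eq_mul_div]
  ring

theorem riskBound_le (hΞ : 0 ≤ Ξ) (hΞ' : 28 * Ξ + 192 ≤ Ξ') {ℓ : ℝ} (hℓ : 0 ≤ ℓ)
    (ht : t ≤ 5 * ℓ) : riskBound Ξ n p L r R t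
      ≤ 12 * R + Ξ' / n * (numParams p L r * L * Real.log n + ℓ) := by
  rw [riskBound, div_mul_eq_mul_div, mul_add]
  gcongr 12 * R + (?_ * (numParams p L r * L * Real.log n) + ?_) / n
  nlinarith

theorem IsLargeSample.exp_variance_pow_le (hn : IsLargeSample n p L r B K) (hΞ : 0 < Ξ)
    (hK : 0 ≤ K) (hL : 1 ≤ L) :
    Real.exp (3 * (2 * R + 32 * p * K * ((n : ℝ) ^ 2)⁻¹ ^ 2) / (2 * Ξ)) ^ n
      ≤ Real.exp (n / (4 * Ξ) * (12 * R + 192 * (numParams p L r * L * Real.log n) / n)) := by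
  have hn0 := two_pos.trans_le hn.two_le
  have hinput := hn.mul_mul_sq_inv_le hK
  have hcomplexity := mul_le_mul_of_nonneg_right (hn.half_le_numParams_mul hL)
    (one_div_nonneg.2 hn0.le)
  rw [← Real.exp_nat_mul, Real.exp_le_exp]
  calc n * (3 * (2 * R + 32 * p * K * ((n : ℝ) ^ 2)⁻¹ ^ 2) / (2 * Ξ))
      = n / (4 * Ξ) * (12 * R + 192 * (p * K * ((n : ℝ) ^ 2)⁻¹ ^ 2)) := by ring
    _ ≤ n / (4 * Ξ) * (12 * R + 192 * (numParams p L r * L * Real.log n * (1 / n))) :=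
        mul_le_mul_of_nonneg_left (by linarith) (by positivity)
    _ = _ := by ring

theorem IsLargeSample.inv_radius_pow_le (hn : IsLargeSample n p L r B K) (hB : 0 < B)
    (hL : 1 ≤ L) :
    ((((2 * r * B) ^ L)⁻¹ * ((n : ℝ) ^ 2)⁻¹ / (2 * B)) ^ numParams p L r)⁻¹
      ≤ Real.exp (7 * (numParams p L r * L * Real.log n)) := by
  have hn0 := two_pos.trans_le hn.two_le
  calc ((((2 * r * B) ^ L)⁻¹ * ((n : ℝ) ^ 2)⁻¹ / (2 * B)) ^ numParams p L r)⁻¹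
      = (2 * B * ((2 * r * B) ^ L * (n : ℝ) ^ 2)) ^ numParams p L r := by
        rw [← inv_pow, inv_div, ← mul_inv, div_inv_eq_mul]
    _ ≤ ((n : ℝ) ^ (7 * L)) ^ numParams p L r := by
        gcongr
        exact hn.mul_pow_mul_sq_le_pow hB.le hL
    _ = Real.exp (7 * (numParams p L r * L * Real.log n)) := by
        rw [← pow_mul, ← Real.exp_log (pow_pos hn0 _), Real.log_pow]
        push_cast
        ring_nf

theorem IsLargeSample.expMoment_le (hn : IsLargeSample n p L r B K) (hΞ : 0 < Ξ) (hK : 0 ≤ K)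
    (hB : 0 < B) (hL : 1 ≤ L) (hr : 1 ≤ r) (hδ : 0 < δ) :
    (2 / δ) ^ 2 * (Real.exp (3 * (2 * R + 32 * p * K * ((2 * r * B) ^ L *
        (((2 * r * B) ^ L)⁻¹ * ((n : ℝ) ^ 2)⁻¹)) ^ 2) / (2 * Ξ)) ^ n * 1
          / (((2 * r * B) ^ L)⁻¹ * ((n : ℝ) ^ 2)⁻¹ / (2 * B)) ^ numParams p L r)
      ≤ Real.exp (n / (4 * Ξ) * riskBound Ξ n p L r R (2 * Real.log (2 / δ))) := by
  have hn0 := two_pos.trans_le hn.two_le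
  have hδexp : (2 / δ) ^ 2 = Real.exp (2 * Real.log (2 / δ)) := by
    rw [two_mul, Real.exp_add, Real.exp_log (by positivity), sq]
  rw [mul_inv_cancel_left₀ (by positivity), mul_one, hδexp,
    div_eq_mul_inv (_ ^ n)]
  refine (mul_le_mul_of_nonneg_left (mul_le_mul (hn.exp_variance_pow_le hΞ hK hL)
    (hn.inv_radius_pow_le hB hL) (by positivity) (Real.exp_pos _).le)
      (Real.exp_pos _).le).trans_eq ?_
  rw [← Real.exp_add, ← Real.exp_add, riskBound]
  congr 1
  field_simp
  ring

end RiskBound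

/-! ### Oracle inequalities -/

theorem log_two_div_half_le {δ : ℝ} (hδ : 0 < δ) (hδ1 : δ ≤ 1) :
    Real.log (2 / (δ / 2)) ≤ 2 * Real.log (2 / δ) := by
  rw [two_mul, ← Real.log_mul (by positivity) (by positivity)]
  refine Real.log_le_log (by positivity) ?_
  rw [div_mul_div_comm, div_div_eq_mul_div]
  gcongr
  nlinarith

theorem log_two_div_nonneg {δ : ℝ} (hδ : 0 < δ) (hδ1 : δ ≤ 1) : 0 ≤ Real.log (2 / δ) :=
  Real.log_nonneg ((one_le_div hδ).2 (by linarith))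

namespace IsExperiment

variable {p L r n : ℕ} {Ω : Type*} [MeasurableSpace Ω] {P : Measure Ω} [IsProbabilityMeasure P]
  {X : Ω → EuclideanSpace ℝ (Fin p)} {Y : Ω → ℝ} {f : EuclideanSpace ℝ (Fin p) → ℝ}
  {C K σ Γ Ξ B ρ : ℝ} {D : Fin n → Ω → EuclideanSpace ℝ (Fin p) × ℝ} {θs : Param p L r}
  {d : Fin n → EuclideanSpace ℝ (Fin p) × ℝ} {t δ : ℝ}

variable (E : IsExperiment P X Y f C K σ Γ Ξ B ρ D θs)

include E

theorem memLp_of_abs_le {h : EuclideanSpace ℝ (Fin p) → ℝ} (hh : Measurable h)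
    (hhC : ∀ᵐ x ∂(P.map X), |h x| ≤ C) : MemLp h 2 (P.map X) :=
  have := E.model.isProbabilityMeasure_map
  MemLp.of_bound hh.aestronglyMeasurable C hhC

theorem memLp_regression : MemLp f 2 (P.map X) :=
  E.memLp_of_abs_le E.model.measurable_f E.model.bounded

theorem memLp_clipped (θ : Param p L r) : MemLp (clipped C θ) 2 (P.map X) :=
  E.memLp_of_abs_le (measurable_clipped C θ) (ae_of_all _ (abs_clipped_le E.C_nonneg θ))

theorem memLp_posteriorMean (d : Fin n → EuclideanSpace ℝ (Fin p) × ℝ) :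
    MemLp (posteriorMean L r C B (n / Ξ) ρ d) 2 (P.map X) :=
  have := E.isProbabilityMeasure_posterior d
  E.memLp_of_abs_le (measurable_posteriorMean d)
    (ae_of_all _ (abs_posteriorMean_le E.C_nonneg d))

theorem excessRisk_clipped (θ : Param p L r) :
    excessRisk P X Y f (clipped C θ) = sqDist (P.map X) f (clipped C θ) :=
  E.model.excessRisk_eq_sqDist (measurable_clipped C θ)
    (ae_of_all _ (abs_clipped_le E.C_nonneg θ))

theorem excessRisk_posteriorMean (d : Fin n → EuclideanSpace ℝ (Fin p) × ℝ) :
    excessRisk P X Y f (posteriorMean L r C B (n / Ξ) ρ d)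
      = sqDist (P.map X) f (posteriorMean L r C B (n / Ξ) ρ d) :=
  have := E.isProbabilityMeasure_posterior d
  E.model.excessRisk_eq_sqDist (measurable_posteriorMean d)
    (ae_of_all _ (abs_posteriorMean_le E.C_nonneg d))

theorem measurable_sqDist_clipped :
    Measurable fun θ : Param p L r => sqDist (P.map X) f (clipped C θ) :=
  have := E.model.isProbabilityMeasure_map
  measurable_sqDist E.model.measurable_f (measurable_uncurry_clipped C)

theorem integrable_sqDist_clipped {π : Measure (Param p L r)} [IsFiniteMeasure π] :
    Integrable (fun θ => sqDist (P.map X) f (clipped C θ)) π := by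
  have := E.model.isProbabilityMeasure_map
  refine Integrable.of_bound E.measurable_sqDist_clipped.aestronglyMeasurable ((2 * C) ^ 2)
    (ae_of_all _ fun θ => ?_)
  rw [Real.norm_of_nonneg (sqDist_nonneg _ _ _)]
  exact sqDist_le E.model.measurable_f (measurable_clipped C θ) E.model.bounded
    (ae_of_all _ (abs_clipped_le E.C_nonneg θ))

theorem measure_not_hasExpMomentLE_le (hδ : 0 < δ) :
    P {ω | ¬ HasExpMomentLE (surrogatePosterior L r C B (n / Ξ) ρ fun i => D i ω)
      (fun θ => sqDist (P.map X) f (clipped C θ)) (n / (4 * Ξ))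
        (riskBound Ξ n p L r (sqDist (P.map X) f (clipped C θs)) (2 * Real.log (2 / δ)))}
      ≤ ENNReal.ofReal δ := by
  have hB := E.B_pos
  have hn := E.large
  have h2 := hn.two_le
  have h2rB : 1 ≤ 2 * r * B := by linarith [E.one_le_mul]
  have := isProbabilityMeasure_prior (p := p) (L := L) (r := r) hB
  have hs := E.measurable_sqDist_clipped
  have huB : ((2 * r * B) ^ L)⁻¹ * ((n : ℝ) ^ 2)⁻¹ ≤ 2 * B :=
    calc ((2 * r * B) ^ L)⁻¹ * ((n : ℝ) ^ 2)⁻¹ ≤ 1 * 1 := by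
          gcongr
          exacts [inv_le_one_of_one_le₀ (one_le_pow₀ h2rB),
            inv_le_one_of_one_le₀ (one_le_pow₀ (by linarith))]
      _ ≤ 2 * B := by linarith [E.one_le_B]
  have hcancel : ∫⁻ θ, ENNReal.ofReal (Real.exp (n / (4 * Ξ) * sqDist (P.map X) f (clipped C θ)))
      * ENNReal.ofReal (Real.exp (-(sqDist (P.map X) f (clipped C θ) / (4 * Ξ)))) ^ n
        ∂(prior p L r B) ≤ ENNReal.ofReal 1 := by
    refine (lintegral_mono (g := fun _ => 1) fun θ => le_of_eq ?_).trans (by simp)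
    rw [← ENNReal.ofReal_pow (by positivity), ← ENNReal.ofReal_mul (by positivity),
      ← Real.exp_nat_mul, ← Real.exp_add, mul_neg, div_mul_comm, mul_comm, add_neg_cancel,
      Real.exp_zero, ENNReal.ofReal_one]
  refine le_trans (measure_mono ?_)
    (E.measure_not_lintegral_posterior_le_le (by positivity) huB (by fun_prop) one_pos hcancel hδ)
  intro ω hω hle
  refine hω (hle.trans (ENNReal.ofReal_le_ofReal ?_))
  exact hn.expMoment_le E.Ξ_pos (by linarith [E.one_le_K]) hB E.one_le_L E.one_le_r hδ

theorem posterior_compl_sqDist_le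
    (h : HasExpMomentLE (surrogatePosterior L r C B (n / Ξ) ρ d)
      (fun θ => sqDist (P.map X) f (clipped C θ)) (n / (4 * Ξ))
        (riskBound Ξ n p L r (sqDist (P.map X) f (clipped C θs)) t)) {η : ℝ} (hη : 0 < η) :
    surrogatePosterior L r C B (n / Ξ) ρ d {θ | sqDist (P.map X) f (clipped C θ)
      ≤ riskBound Ξ n p L r (sqDist (P.map X) f (clipped C θs)) (t + Real.log (1 / η))}ᶜ
        ≤ ENNReal.ofReal η := by
  have hΞ := E.Ξ_pos
  have hn := two_pos.trans_le E.large.two_le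
  simp only [riskBound_add]
  exact h.measure_compl_le E.measurable_sqDist_clipped.aemeasurable (by positivity) hη

theorem sqDist_posteriorMean_le
    (h : HasExpMomentLE (surrogatePosterior L r C B (n / Ξ) ρ d)
      (fun θ => sqDist (P.map X) f (clipped C θ)) (n / (4 * Ξ))
        (riskBound Ξ n p L r (sqDist (P.map X) f (clipped C θs)) t)) :
    sqDist (P.map X) f (posteriorMean L r C B (n / Ξ) ρ d)
      ≤ riskBound Ξ n p L r (sqDist (P.map X) f (clipped C θs)) t := by
  have hΞ := E.Ξ_pos
  have hn := two_pos.trans_le E.large.two_le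
  have := E.isProbabilityMeasure_posterior d
  have := E.model.isProbabilityMeasure_map
  exact (sqDist_integral_le E.model.measurable_f E.model.bounded (measurable_uncurry_clipped C)
    (abs_clipped_le E.C_nonneg)).trans
      (h.integral_le E.integrable_sqDist_clipped (by positivity))

variable {Ξ' : ℝ} (hΞ' : 28 * Ξ + 192 ≤ Ξ') (hδ : 0 < δ) (hδ1 : δ ≤ 1)

include hΞ' hδ hδ1

theorem oracle_draw :
    ENNReal.ofReal (1 - δ) ≤ ∫⁻ ω, surrogatePosterior L r C B (n / Ξ) ρ (fun i => D i ω)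
      {θ | excessRisk P X Y f (clipped C θ) ≤ 12 * excessRisk P X Y f (clipped C θs)
        + Ξ' / n * (numParams p L r * L * Real.log n + Real.log (2 / δ))} ∂P := by
  have hℓ := log_two_div_nonneg hδ hδ1
  rw [← add_halves δ]
  refine ofReal_one_sub_add_le_lintegral (half_pos hδ).le (half_pos hδ).le (by linarith)
    (le_trans (measure_mono ?_) (E.measure_not_hasExpMomentLE_le (half_pos hδ)))
  intro ω hω h
  refine hω ?_
  have := E.isProbabilityMeasure_posterior fun i => D i ω
  refine (ofReal_one_sub_le_of_compl (half_pos hδ).le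
    (E.posterior_compl_sqDist_le h (half_pos hδ))).trans (measure_mono fun θ hθ => ?_)
  simp only [Set.mem_ofPred_eq, E.excessRisk_clipped, add_halves] at hθ ⊢
  refine hθ.trans (riskBound_le E.Ξ_pos.le hΞ' hℓ ?_)
  rw [one_div_div]
  linarith [log_two_div_half_le hδ hδ1]

theorem oracle_mean :
    ENNReal.ofReal (1 - δ) ≤
      P {ω | excessRisk P X Y f (posteriorMean L r C B (n / Ξ) ρ fun i => D i ω)
        ≤ 12 * excessRisk P X Y f (clipped C θs)
          + Ξ' / n * (numParams p L r * L * Real.log n + Real.log (2 / δ))} := by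
  have hℓ := log_two_div_nonneg hδ hδ1
  refine ofReal_one_sub_le_of_compl hδ.le
    (le_trans (measure_mono ?_) (E.measure_not_hasExpMomentLE_le hδ))
  intro ω hω h
  refine hω ?_
  rw [Set.mem_ofPred_eq, E.excessRisk_posteriorMean, E.excessRisk_clipped]
  exact (E.sqDist_posteriorMean_le h).trans (riskBound_le E.Ξ_pos.le hΞ' hℓ (by linarith))

end IsExperiment

/-! ### The diameter of the credible ball -/

namespace IsExperiment

variable {p L r n : ℕ} {Ω : Type*} [MeasurableSpace Ω] {P : Measure Ω} [IsProbabilityMeasure P]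
  {X : Ω → EuclideanSpace ℝ (Fin p)} {Y : Ω → ℝ} {f : EuclideanSpace ℝ (Fin p) → ℝ}
  {C K σ Γ Ξ B ρ : ℝ} {D : Fin n → Ω → EuclideanSpace ℝ (Fin p) × ℝ} {θs : Param p L r}
  {d : Fin n → EuclideanSpace ℝ (Fin p) × ℝ} {Ξ' α : ℝ}

variable (E : IsExperiment P X Y f C K σ Γ Ξ B ρ D θs)

include E

theorem rateSq_eq : rateSq C Ξ' n (P.map X) f θs
    = 12 * sqDist (P.map X) f (clipped C θs) + Ξ' / n * (numParams p L r * L * Real.log n) := by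
  rw [rateSq, sq_l2Norm_sub E.memLp_regression (E.memLp_clipped θs)]

variable (hΞ' : 28 * Ξ + 192 ≤ Ξ') (hα : 0 < α) (hα1 : α < 1)

include hΞ' hα hα1

theorem criticalValue_le
    (h : HasExpMomentLE (surrogatePosterior L r C B (n / Ξ) ρ d)
      (fun θ => sqDist (P.map X) f (clipped C θ)) (n / (4 * Ξ))
        (riskBound Ξ n p L r (sqDist (P.map X) f (clipped C θs)) (2 * Real.log (2 / α)))) :
    criticalValue L r C B (n / Ξ) ρ (P.map X) d α
      ≤ 2 * √(2 * rateSq C Ξ' n (P.map X) f θs + 4 * Ξ' / n * Real.log (2 / α)) := by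
  have hΞ := E.Ξ_pos
  have hn := two_pos.trans_le E.large.two_le
  have hℓ := log_two_div_nonneg hα hα1.le
  have := E.isProbabilityMeasure_posterior d
  set m := posteriorMean L r C B (n / Ξ) ρ d
  set V := Ξ' / n * Real.log (2 / α) with hV
  have hV0 : 0 ≤ V := mul_nonneg (div_nonneg (by linarith) hn.le) hℓ
  have hrate : 0 < rateSq C Ξ' n (P.map X) f θs := by
    have hcomplexity := one_half_pos.trans_le (E.large.half_le_numParams_mul E.one_le_L)
    have := sqDist_nonneg (P.map X) f (clipped C θs)
    have : 0 < Ξ' := by linarith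
    rw [E.rateSq_eq]
    positivity
  have hbound : ∀ t ≤ 5 * Real.log (2 / α),
      riskBound Ξ n p L r (sqDist (P.map X) f (clipped C θs)) t
        ≤ rateSq C Ξ' n (P.map X) f θs + V := fun t ht => by
    rw [E.rateSq_eq, hV, add_assoc, ← mul_add]
    exact riskBound_le hΞ.le hΞ' hℓ ht
  have hmean := (E.sqDist_posteriorMean_le h).trans (hbound _ (by linarith))
  have hdraw : ENNReal.ofReal (1 - α / 2) ≤ surrogatePosterior L r C B (n / Ξ) ρ d
      {θ | sqDist (P.map X) f (clipped C θ) ≤ rateSq C Ξ' n (P.map X) f θs + V} := by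
    refine (ofReal_one_sub_le_of_compl (half_pos hα).le
      (E.posterior_compl_sqDist_le h (half_pos hα))).trans (measure_mono fun θ hθ => ?_)
    exact hθ.trans (hbound _ (by rw [one_div_div]; linarith))
  rw [show 4 * Ξ' / n * Real.log (2 / α) = 4 * V by ring]
  refine csInf_le ⟨0, fun τ hτ => hτ.1.le⟩ ⟨by positivity, ?_⟩
  refine (by linarith : 1 - α < 1 - α / 2).trans_le
    ((ENNReal.ofReal_le_iff_le_toReal (measure_ne_top _ _)).1
      (hdraw.trans (measure_mono fun θ hθ => ?_)))
  rw [Set.mem_ofPred_eq] at hθ ⊢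
  rw [l2Norm_sub_le_iff (E.memLp_posteriorMean d) (E.memLp_clipped θ) (by positivity), mul_pow,
    Real.sq_sqrt (by positivity)]
  linarith [sqDist_le_two_mul E.memLp_regression (E.memLp_posteriorMean d) (E.memLp_clipped θ)]

theorem diam_credibleBall_le :
    ENNReal.ofReal (1 - α) ≤ P {ω | l2Diam (P.map X)
      (credibleBall L r C B (n / Ξ) ρ (P.map X) (fun i => D i ω)
        (criticalValue L r C B (n / Ξ) ρ (P.map X) (fun i => D i ω) α))
      ≤ ENNReal.ofReal (4 * √(2 * rateSq C Ξ' n (P.map X) f θs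
        + 4 * Ξ' / n * Real.log (2 / α)))} := by
  refine ofReal_one_sub_le_of_compl hα.le
    (le_trans (measure_mono ?_) (E.measure_not_hasExpMomentLE_le hα))
  intro ω hω h
  refine hω ((l2Diam_l2Ball_le (E.memLp_posteriorMean _)).trans (ENNReal.ofReal_le_ofReal ?_))
  linarith [E.criticalValue_le hΞ' hα hα1 h]

end IsExperiment

/-! ### Coverage of the inflated credible ball -/

theorem sqrt_numParams_div_le {p L r n : ℕ} {B K : ℝ} (hn : IsLargeSample n p L r B K)
    (hB : 1 ≤ B) (hp : 1 ≤ p) (hL : 1 ≤ L) (hr : 1 ≤ r) :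
    √(numParams p L r / n) ≤ 2 * (2 * r * B) ^ L := by
  have hn0 := two_pos.trans_le hn.two_le
  have hpn : (p : ℝ) ≤ n := by exact_mod_cast hn.2.2.2.2.2
  have hr1 : (1 : ℝ) ≤ r := by exact_mod_cast hr
  have hcount : (numParams p L r : ℝ) ≤ 4 * p * L * r ^ 2 := by exact_mod_cast numParams_le hp hL hr
  have hLpow : (L : ℝ) ≤ (2 ^ L) ^ 2 := by
    exact_mod_cast L.lt_two_pow_self.le.trans (Nat.le_self_pow two_ne_zero _)
  have hrpow : (r : ℝ) ≤ (r * B) ^ L :=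
    (le_mul_of_one_le_right (by linarith) hB).trans
      (le_self_pow₀ (one_le_mul_of_one_le_of_one_le hr1 hB) (Nat.one_le_iff_ne_zero.1 hL))
  refine Real.sqrt_le_iff.2 ⟨by positivity, (div_le_iff₀ hn0).2 ?_⟩
  calc (numParams p L r : ℝ) ≤ 4 * p * L * r ^ 2 := hcount
    _ ≤ 4 * n * (2 ^ L) ^ 2 * ((r * B) ^ L) ^ 2 := by gcongr
    _ = (2 * (2 * r * B) ^ L) ^ 2 * n := by
        rw [mul_assoc 2 (r : ℝ) B, mul_pow 2 (r * B)]
        ring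

theorem smallBall_bound_le {p L r n : ℕ} {Ξ B K A R s v ζ η δ : ℝ} (hn : 0 < n) (hΞ : 0 < Ξ)
    (hB : 0 < B) (hs : 0 < s) (hv : 0 < v) (hζ : 0 < ζ)
    (hsv : (s * (s⁻¹ * v)) ^ 2 = numParams p L r / n)
    (hR : R ≤ A * Ξ * numParams p L r / n)
    (hζ1 : 2 * ζ * Real.exp (3 * A + 48 * p * K / Ξ) ≤ 1)
    (hζη : (2 / δ) ^ 2 * (2 * ζ * Real.exp (3 * A + 48 * p * K / Ξ)) ≤ η) :
    (2 / δ) ^ 2 * (Real.exp (3 * (2 * R + 32 * p * K * (s * (s⁻¹ * v)) ^ 2) / (2 * Ξ)) ^ n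
      * (s⁻¹ * (ζ * v) / B) ^ numParams p L r / (s⁻¹ * v / (2 * B)) ^ numParams p L r) ≤ η := by
  have hexp : Real.exp (3 * (2 * R + 32 * p * K * (s * (s⁻¹ * v)) ^ 2) / (2 * Ξ)) ^ n
      ≤ Real.exp (3 * A + 48 * p * K / Ξ) ^ numParams p L r := by
    rw [← Real.exp_nat_mul, ← Real.exp_nat_mul, Real.exp_le_exp, hsv]
    calc n * (3 * (2 * R + 32 * p * K * (numParams p L r / n)) / (2 * Ξ))
        ≤ n * (3 * (2 * (A * Ξ * numParams p L r / n)
          + 32 * p * K * (numParams p L r / n)) / (2 * Ξ)) := by gcongr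
      _ = numParams p L r * (3 * A + 48 * p * K / Ξ) := by
        field_simp
        ring
  have hratio : s⁻¹ * (ζ * v) / B / (s⁻¹ * v / (2 * B)) = 2 * ζ := by field_simp
  refine le_trans ?_ hζη
  gcongr
  calc _ ≤ Real.exp (3 * A + 48 * p * K / Ξ) ^ numParams p L r
        * (s⁻¹ * (ζ * v) / B) ^ numParams p L r / (s⁻¹ * v / (2 * B)) ^ numParams p L r := by
        gcongr
    _ = (2 * ζ * Real.exp (3 * A + 48 * p * K / Ξ)) ^ numParams p L r := by
        rw [mul_div_assoc, ← div_pow, ← mul_pow, hratio, mul_comm]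
    _ ≤ 2 * ζ * Real.exp (3 * A + 48 * p * K / Ξ) :=
        pow_le_of_le_one (by positivity) hζ1 (Nat.one_le_iff_ne_zero.1 one_le_numParams)

namespace IsExperiment

variable {p L r n : ℕ} {Ω : Type*} [MeasurableSpace Ω] {P : Measure Ω} [IsProbabilityMeasure P]
  {X : Ω → EuclideanSpace ℝ (Fin p)} {Y : Ω → ℝ} {f : EuclideanSpace ℝ (Fin p) → ℝ}
  {C K σ Γ Ξ B ρ : ℝ} {D : Fin n → Ω → EuclideanSpace ℝ (Fin p) × ℝ} {θs : Param p L r}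
  {d : Fin n → EuclideanSpace ℝ (Fin p) × ℝ} {A α δ η ζ : ℝ}

variable (E : IsExperiment P X Y f C K σ Γ Ξ B ρ D θs)

include E

theorem measure_not_posterior_smallBall_le
    (hA : sqDist (P.map X) f (clipped C θs) ≤ A * Ξ * numParams p L r / n)
    (hδ : 0 < δ) (hζ : 0 < ζ)
    (hζ1 : 2 * ζ * Real.exp (3 * A + 48 * p * K / Ξ) ≤ 1)
    (hζη : (2 / δ) ^ 2 * (2 * ζ * Real.exp (3 * A + 48 * p * K / Ξ)) ≤ η) :
    P {ω | ¬ surrogatePosterior L r C B (n / Ξ) ρ (fun i => D i ω)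
      {θ | ‖θ‖ ≤ ((2 * r * B) ^ L)⁻¹ * (ζ * √(numParams p L r / n))} ≤ ENNReal.ofReal η}
        ≤ ENNReal.ofReal δ := by
  have hB := E.B_pos
  have hΞ := E.Ξ_pos
  have hn : 0 < n := E.n_ne_zero.bot_lt
  have hscale : 0 < (2 * r * B) ^ L := pow_pos (by linarith [E.one_le_mul]) L
  have hP : 0 < numParams p L r := one_le_numParams
  have hv : 0 < √(numParams p L r / n) := by positivity
  have hradius : ((2 * r * B) ^ L)⁻¹ * √(numParams p L r / n) ≤ 2 * B := by
    rw [inv_mul_le_iff₀ hscale]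
    nlinarith [sqrt_numParams_div_le E.large E.one_le_B E.one_le_p E.one_le_L E.one_le_r,
      E.one_le_B]
  have hball : MeasurableSet
      {θ : Param p L r | ‖θ‖ ≤ ((2 * r * B) ^ L)⁻¹ * (ζ * √(numParams p L r / n))} :=
    measurableSet_le measurable_norm measurable_const
  have hprior : ∫⁻ θ : Param p L r, Set.indicator
      {θ | ‖θ‖ ≤ ((2 * r * B) ^ L)⁻¹ * (ζ * √(numParams p L r / n))} 1 θ
        * ENNReal.ofReal (Real.exp (-(sqDist (P.map X) f (clipped C θ) / (4 * Ξ)))) ^ n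
          ∂(prior p L r B) ≤ ENNReal.ofReal
            ((((2 * r * B) ^ L)⁻¹ * (ζ * √(numParams p L r / n)) / B) ^ numParams p L r) := by
    refine le_trans ?_ (prior_closedBall_zero_le hB (by positivity))
    rw [← lintegral_indicator_one hball]
    refine lintegral_mono fun θ => mul_le_of_le_one_right' (pow_le_one₀ zero_le ?_)
    rw [ENNReal.ofReal_le_one, Real.exp_le_one_iff, neg_nonpos]
    exact div_nonneg (sqDist_nonneg _ _ _) (by positivity)
  refine le_trans (measure_mono ?_) (E.measure_not_lintegral_posterior_le_le
    (mul_pos (inv_pos.2 hscale) hv) hradius (measurable_one.indicator hball) (by positivity)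
      hprior hδ)
  intro ω hω hle
  rw [lintegral_indicator_one hball] at hle
  refine hω (hle.trans (ENNReal.ofReal_le_ofReal ?_))
  refine smallBall_bound_le hn hΞ hB hscale hv hζ ?_ hA hζ1 hζη
  rw [mul_inv_cancel_left₀ hscale.ne', Real.sq_sqrt (by positivity)]

theorem le_paramCriticalValue (hα : 0 < α) (hα1 : α < 1)
    (h : surrogatePosterior L r C B (n / Ξ) ρ d
      {θ | ‖θ‖ ≤ ((2 * r * B) ^ L)⁻¹ * (ζ * √(numParams p L r / n))}
        ≤ ENNReal.ofReal (1 - α)) :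
    ζ * √(numParams p L r / n) ≤ paramCriticalValue L r C B (n / Ξ) ρ d α := by
  have hB := E.B_pos
  have hscale : 0 < (2 * r * B) ^ L := pow_pos (by linarith [E.one_le_mul]) L
  have := E.isProbabilityMeasure_posterior d
  refine le_csInf ⟨(2 * r * B) ^ L * B, by positivity, ?_⟩ fun τ hτ => ?_
  · rw [inv_mul_cancel_left₀ hscale.ne', surrogatePosterior_real_closedBall hB.le d]
    linarith
  · by_contra! hlt
    refine hτ.2.not_ge (ENNReal.toReal_le_of_le_ofReal (by linarith)
      ((measure_mono fun θ hθ => ?_).trans h))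
    rw [Set.mem_ofPred_eq] at hθ ⊢
    exact hθ.trans (by gcongr)

end IsExperiment

/-- The factor `ζ` for which the parameter ball of radius `(2rB)^{-L} ζ √(P/n)` has posterior mass
at most `1 - α`, up to an event of probability `α / 2`. -/
noncomputable def smallBallFactor (Ξ K : ℝ) (p : ℕ) (α A : ℝ) : ℝ :=
  (1 - α) * α ^ 2 / (32 * Real.exp (3 * A + 48 * p * K / Ξ))

/-- The constant in front of `P L log n / n` in the bound on the squared error of the posterior
mean which holds with probability `1 - δ` when the oracle error is at most `A Ξ P / n`. -/
noncomputable def meanErrorConst (Ξ A δ : ℝ) : ℝ :=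
  24 * A * Ξ + 28 * Ξ + 192 + 16 * Ξ * Real.log (2 / δ)

/-- The inflation factor `κ` of the credible ball: the posterior mean misses `f` by at most
`√(meanErrorConst) √(P L log n / n)`, while `τ_α^θ` is at least `ζ √(P / n)`. -/
noncomputable def coverageFactor (Ξ K : ℝ) (p : ℕ) (α A : ℝ) : ℝ :=
  √(meanErrorConst Ξ A (α / 2)) / smallBallFactor Ξ K p α A + 1

section Constants

variable {Ξ K α A δ : ℝ} {p : ℕ}

theorem smallBallFactor_pos (hα : 0 < α) (hα1 : α < 1) : 0 < smallBallFactor Ξ K p α A := by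
  have : 0 < 1 - α := by linarith
  unfold smallBallFactor
  positivity

theorem two_mul_smallBallFactor_mul_exp :
    2 * smallBallFactor Ξ K p α A * Real.exp (3 * A + 48 * p * K / Ξ) = (1 - α) * α ^ 2 / 16 := by
  rw [smallBallFactor]
  field_simp
  ring

theorem meanErrorConst_pos (hΞ : 0 < Ξ) (hA : 0 ≤ A) (hδ : 0 < δ) (hδ1 : δ ≤ 1) :
    0 < meanErrorConst Ξ A δ := by
  have := log_two_div_nonneg hδ hδ1
  unfold meanErrorConst
  positivity

theorem one_lt_coverageFactor (hΞ : 0 < Ξ) (hA : 0 ≤ A) (hα : 0 < α) (hα1 : α < 1) :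
    1 < coverageFactor Ξ K p α A :=
  lt_add_of_pos_left _ (div_pos
    (Real.sqrt_pos.2 (meanErrorConst_pos hΞ hA (half_pos hα) (by linarith)))
    (smallBallFactor_pos hα hα1))

theorem sqrt_meanErrorConst_le (hα : 0 < α) (hα1 : α < 1) :
    √(meanErrorConst Ξ A (α / 2)) ≤ coverageFactor Ξ K p α A * smallBallFactor Ξ K p α A := by
  have hζ := smallBallFactor_pos (Ξ := Ξ) (K := K) (p := p) (A := A) hα hα1
  rw [coverageFactor, add_mul, div_mul_cancel₀ _ hζ.ne', one_mul]
  linarith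

end Constants

theorem IsLargeSample.riskBound_le_meanErrorConst_mul {p L r n : ℕ} {B K Ξ A R δ : ℝ}
    (hn : IsLargeSample n p L r B K) (hL : 1 ≤ L) (hΞ : 0 ≤ Ξ) (hA : 0 ≤ A) (hδ : 0 < δ)
    (hδ1 : δ ≤ 1) (hR : R ≤ A * Ξ * numParams p L r / n) :
    riskBound Ξ n p L r R (2 * Real.log (2 / δ))
      ≤ meanErrorConst Ξ A δ * (L * Real.log n * (numParams p L r / n)) := by
  have hn0 := two_pos.trans_le hn.two_le
  have hℓ := log_two_div_nonneg hδ hδ1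
  have hone : 1 ≤ 2 * (numParams p L r * L * Real.log n) := by
    linarith [hn.half_le_numParams_mul hL]
  have hparams : (numParams p L r : ℝ) ≤ 2 * (numParams p L r * L * Real.log n) := by
    have hL' : (1 : ℝ) ≤ L := by exact_mod_cast hL
    nlinarith [mul_le_mul hL' hn.half_le_log one_half_pos.le (by linarith),
      Nat.cast_nonneg (α := ℝ) (numParams p L r)]
  calc riskBound Ξ n p L r R (2 * Real.log (2 / δ))
      ≤ 12 * (A * Ξ * numParams p L r / n)
        + ((28 * Ξ + 192) * (numParams p L r * L * Real.log n)
          + 4 * Ξ * (2 * Real.log (2 / δ))) / n := by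
        unfold riskBound
        gcongr
    _ = (12 * (A * Ξ) * numParams p L r + (28 * Ξ + 192) * (numParams p L r * L * Real.log n)
          + 8 * Ξ * Real.log (2 / δ) * 1) / n := by ring
    _ ≤ (12 * (A * Ξ) * (2 * (numParams p L r * L * Real.log n))
          + (28 * Ξ + 192) * (numParams p L r * L * Real.log n)
          + 8 * Ξ * Real.log (2 / δ) * (2 * (numParams p L r * L * Real.log n))) / n := by gcongr
    _ = meanErrorConst Ξ A δ * (L * Real.log n * (numParams p L r / n)) := by
        rw [meanErrorConst]
        ring

namespace IsExperiment

variable {p L r n : ℕ} {Ω : Type*} [MeasurableSpace Ω] {P : Measure Ω} [IsProbabilityMeasure P]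
  {X : Ω → EuclideanSpace ℝ (Fin p)} {Y : Ω → ℝ} {f : EuclideanSpace ℝ (Fin p) → ℝ}
  {C K σ Γ Ξ B ρ : ℝ} {D : Fin n → Ω → EuclideanSpace ℝ (Fin p) × ℝ} {θs : Param p L r}
  {d : Fin n → EuclideanSpace ℝ (Fin p) × ℝ} {A α : ℝ}

variable (E : IsExperiment P X Y f C K σ Γ Ξ B ρ D θs)

include E

theorem sqDist_oracle_le (hrisk : L * Real.log n * excessRisk P X Y f (clipped C θs)
      ≤ A * (numParams p L r * L * Real.log n / (n / Ξ))) :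
    sqDist (P.map X) f (clipped C θs) ≤ A * Ξ * numParams p L r / n := by
  have hlog : 0 < Real.log n := one_half_pos.trans_le E.large.half_le_log
  have hL : (0 : ℝ) < L := by exact_mod_cast E.one_le_L
  rw [E.excessRisk_clipped] at hrisk
  refine le_of_mul_le_mul_left (hrisk.trans_eq ?_) (mul_pos hL hlog)
  field_simp

variable (hα : 0 < α) (hα1 : α < 1)

include hα hα1

theorem mem_credibleBall_coverageFactor_mul
    (hmean : sqDist (P.map X) f (posteriorMean L r C B (n / Ξ) ρ d)
      ≤ meanErrorConst Ξ A (α / 2) * (L * Real.log n * (numParams p L r / n)))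
    (hcrit : smallBallFactor Ξ K p α A * √(numParams p L r / n)
      ≤ paramCriticalValue L r C B (n / Ξ) ρ d α) :
    f ∈ credibleBall L r C B (n / Ξ) ρ (P.map X) d
      (coverageFactor Ξ K p α A * √(L * Real.log n)
        * paramCriticalValue L r C B (n / Ξ) ρ d α) := by
  refine ⟨E.memLp_regression, ?_⟩
  have hζ := smallBallFactor_pos (Ξ := Ξ) (K := K) (p := p) (A := A) hα hα1
  have hκ : 0 ≤ coverageFactor Ξ K p α A :=
    add_nonneg (div_nonneg (Real.sqrt_nonneg _) hζ.le) zero_le_one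
  have hN : 0 ≤ L * Real.log n * (numParams p L r / n : ℝ) := by positivity
  calc l2Norm (P.map X) (fun x => f x - posteriorMean L r C B (n / Ξ) ρ d x)
      ≤ √(meanErrorConst Ξ A (α / 2)) * √(L * Real.log n * (numParams p L r / n)) := by
        rw [l2Norm_sub_le_iff (E.memLp_posteriorMean d) E.memLp_regression (by positivity),
          sqDist_comm, ← Real.sqrt_mul' _ hN, Real.sq_sqrt]
        exacts [hmean, (sqDist_nonneg _ _ _).trans hmean]
    _ ≤ coverageFactor Ξ K p α A * smallBallFactor Ξ K p α A
          * √(L * Real.log n * (numParams p L r / n)) := by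
        gcongr
        exact sqrt_meanErrorConst_le hα hα1
    _ = coverageFactor Ξ K p α A * √(L * Real.log n)
          * (smallBallFactor Ξ K p α A * √(numParams p L r / n)) := by
        rw [Real.sqrt_mul (by positivity)]
        ring
    _ ≤ _ := by gcongr

theorem coverage (hA : 0 ≤ A) (hrisk : L * Real.log n * excessRisk P X Y f (clipped C θs)
      ≤ A * (numParams p L r * L * Real.log n / (n / Ξ))) :
    ENNReal.ofReal (1 - α) ≤ P {ω | f ∈ credibleBall L r C B (n / Ξ) ρ (P.map X) (fun i => D i ω)
      (coverageFactor Ξ K p α A * √(L * Real.log n)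
        * paramCriticalValue L r C B (n / Ξ) ρ (fun i => D i ω) α)} := by
  have hα2 := half_pos hα
  have horacle := E.sqDist_oracle_le hrisk
  have hball := E.measure_not_posterior_smallBall_le (η := 1 - α) horacle hα2
    (smallBallFactor_pos hα hα1)
    (by rw [two_mul_smallBallFactor_mul_exp]; nlinarith [pow_le_one₀ (n := 2) hα.le hα1.le])
    (by rw [two_mul_smallBallFactor_mul_exp]; field_simp; linarith)
  refine ofReal_one_sub_le_of_compl hα.le ?_
  calc P _ ≤ P ({ω | ¬ HasExpMomentLE _ _ _ _} ∪ {ω | ¬ _ ≤ ENNReal.ofReal (1 - α)}) := by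
        refine measure_mono fun ω hω => ?_
        by_contra hgood
        simp only [Set.mem_union, Set.mem_ofPred_eq, not_or, not_not] at hgood
        refine hω (E.mem_credibleBall_coverageFactor_mul hα hα1 ?_
          (E.le_paramCriticalValue hα hα1 hgood.2))
        exact (E.sqDist_posteriorMean_le hgood.1).trans
          (E.large.riskBound_le_meanErrorConst_mul E.one_le_L E.Ξ_pos.le hA hα2 (by linarith)
            horacle)
    _ ≤ ENNReal.ofReal (α / 2) + ENNReal.ofReal (α / 2) :=
        (measure_union_le _ _).trans (add_le_add (E.measure_not_hasExpMomentLE_le hα2) hball)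
    _ = ENNReal.ofReal α := by rw [← ENNReal.ofReal_add hα2.le hα2.le, add_halves]

end IsExperiment

end CredibleBalls

theorem mainTheorem5 (C σ Γ : ℝ) (hC : 1 ≤ C) (hσ : 0 < σ) (hΓ : 0 < Γ) :
    ∃ Ξ₀ > (0 : ℝ), ∃ Ξ₁ > (0 : ℝ), ∃ Ξ₂ > (0 : ℝ),
      -- the oracle inequalities characterizing the constants, and the diameter bound
      (∀ (K B ρ : ℝ) (p L r n : ℕ), 1 ≤ K → 1 ≤ B → 0 < ρ → ρ ≤ 1 → 1 ≤ p → 1 ≤ L → 1 ≤ r →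
        IsLargeSample n p L r B K →
        ∀ (Ω : Type*) [MeasurableSpace Ω] (P : Measure Ω) [IsProbabilityMeasure P]
          (X : Ω → EuclideanSpace ℝ (Fin p)) (Y : Ω → ℝ) (f : EuclideanSpace ℝ (Fin p) → ℝ)
          (D : Fin n → Ω → EuclideanSpace ℝ (Fin p) × ℝ) (θs : Param p L r),
          IsBoundedRegression P X Y f C K σ Γ → IsSample P X Y D → IsOracle P X Y C B θs →
          (∀ δ : ℝ, 0 < δ → δ < 1 →
            ENNReal.ofReal (1 - δ) ≤
              ∫⁻ ω, surrogatePosterior L r C B (n / Ξ₀) ρ (fun i => D i ω)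
                {θ | excessRisk P X Y f (clipped C θ) ≤
                  12 * excessRisk P X Y f (clipped C θs)
                    + Ξ₁ / n * (numParams p L r * L * Real.log n + Real.log (2 / δ))} ∂P) ∧
          (∀ δ : ℝ, 0 < δ → δ < 1 →
            ENNReal.ofReal (1 - δ) ≤
              P {ω | excessRisk P X Y f (posteriorMean L r C B (n / Ξ₀) ρ (fun i => D i ω)) ≤
                12 * excessRisk P X Y f (clipped C θs)
                  + Ξ₂ / n * (numParams p L r * L * Real.log n + Real.log (2 / δ))}) ∧
          (∀ α : ℝ, 0 < α → α < 1 →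
            ENNReal.ofReal (1 - α) ≤
              P {ω | l2Diam (P.map X)
                  (credibleBall L r C B (n / (2 * Ξ₀)) ρ (P.map X) (fun i => D i ω)
                    (criticalValue L r C B (n / (2 * Ξ₀)) ρ (P.map X) (fun i => D i ω) α)) ≤
                ENNReal.ofReal (4 * √(2 * rateSq C Ξ₁ n (P.map X) f θs
                  + 4 * max Ξ₁ Ξ₂ / n * Real.log (2 / α)))})) ∧
      -- the coverage of the inflated ball
      (∀ (K : ℝ) (p : ℕ) (α A : ℝ), 1 ≤ K → 1 ≤ p → 0 < α → α < 1 → 0 < A →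
        ∃ κ > (1 : ℝ), ∀ (B ρ : ℝ) (L r n : ℕ), 1 ≤ B → 0 < ρ → ρ ≤ 1 → 1 ≤ L → 1 ≤ r →
          IsLargeSample n p L r B K →
          ∀ (Ω : Type*) [MeasurableSpace Ω] (P : Measure Ω) [IsProbabilityMeasure P]
            (X : Ω → EuclideanSpace ℝ (Fin p)) (Y : Ω → ℝ) (f : EuclideanSpace ℝ (Fin p) → ℝ)
            (D : Fin n → Ω → EuclideanSpace ℝ (Fin p) × ℝ) (θs : Param p L r),
            IsBoundedRegression P X Y f C K σ Γ → IsSample P X Y D → IsOracle P X Y C B θs →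
            L * Real.log n * excessRisk P X Y f (clipped C θs) ≤
              A * (numParams p L r * L * Real.log n / (n / (2 * Ξ₀))) →
            ENNReal.ofReal (1 - α) ≤
              P {ω | f ∈ credibleBall L r C B (n / (2 * Ξ₀)) ρ (P.map X) (fun i => D i ω)
                (κ * √(L * Real.log n) *
                  paramCriticalValue L r C B (n / (2 * Ξ₀)) ρ (fun i => D i ω) α)}) := by
  set Ξ₀ := 8 * C * Γ + 32 * C ^ 2 + 256 * σ ^ 2
  have hC0 : 0 < C := one_pos.trans_le hC
  have hΞ₀ : 0 < Ξ₀ := by positivity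
  have hT : IsTemperature C σ Γ Ξ₀ := ⟨le_rfl, hC0, hΓ⟩
  have hT2 : IsTemperature C σ Γ (2 * Ξ₀) := ⟨by linarith, hC0, hΓ⟩
  refine ⟨Ξ₀, hΞ₀, 56 * Ξ₀ + 192, by positivity, 56 * Ξ₀ + 192, by positivity, ?_, ?_⟩
  · intro K B ρ p L r n hK hB hρ hρ1 hp hL hr hn Ω _ P _ X Y f D θs H hD hθs
    have E : IsExperiment P X Y f C K σ Γ Ξ₀ B ρ D θs :=
      ⟨H, hD, hT, hn, hK, hB, hp, hL, hr, hρ.le, hρ1, hθs.1⟩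
    have E2 : IsExperiment P X Y f C K σ Γ (2 * Ξ₀) B ρ D θs := { E with temperature := hT2 }
    refine ⟨fun δ hδ hδ1 => E.oracle_draw (by linarith) hδ hδ1.le,
      fun δ hδ hδ1 => E.oracle_mean (by linarith) hδ hδ1.le, fun α hα hα1 => ?_⟩
    rw [max_self]
    exact E2.diam_credibleBall_le (by linarith) hα hα1
  · intro K p α A hK hp hα hα1 hA
    refine ⟨coverageFactor (2 * Ξ₀) K p α A, one_lt_coverageFactor hT2.pos hA.le hα hα1, ?_⟩
    intro B ρ L r n hB hρ hρ1 hL hr hn Ω _ P _ X Y f D θs H hD hθs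
    have E : IsExperiment P X Y f C K σ Γ (2 * Ξ₀) B ρ D θs :=
      ⟨H, hD, hT2, hn, hK, hB, hp, hL, hr, hρ.le, hρ1, hθs.1⟩
    exact E.coverage hα hα1 hA.le
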